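/- Consider two non-degenerate optical parametric amplifiers (NOPAs) with modes $a_1,b_1$ and $a_2,b_2$, pump coupling $\epsilon$, mirror damping rate $\gamma$, amplification-loss rate $\kappa$, connected by two paths with transmission rate $\alpha$, reflection rate $\beta=\sqrt{1-\alpha^2}$ and phase shifts $\theta_1,\theta_2$, and with phase shifters $\phi_1,\phi_2$ at the two outputs: $$\begin{aligned} \dot a_1&=-\tfrac{\gamma+\kappa}2a_1+\tfrac\epsilon2b_1^*-\sqrt\gamma\,\xi_{in,a,1}-\sqrt\kappa\,\xi_{loss,a,1},\\ \dot b_1&=-\tfrac{\gamma+\kappa}2b_1+\tfrac\epsilon2a_1^*-\alpha\gamma e^{i\theta_2}b_2-\alpha\sqrt\gamma e^{i\theta_2}\xi_{in,b,2}-\sqrt\kappa\,\xi_{loss,b,1}-\beta\sqrt\gamma\,\xi_{BS,2},\\ \dot a_2&=-\tfrac{\gamma+\kappa}2a_2+\tfrac\epsilon2b_2^*-\alpha\gamma e^{i\theta_1}a_1-\alpha\sqrt\gamma e^{i\theta_1}\xi_{in,a,1}-\sqrt\kappa\,\xi_{loss,a,2}-\beta\sqrt\gamma\,\xi_{BS,1},\\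 \dot b_2&=-\tfrac{\gamma+\kappa}2b_2+\tfrac\epsilon2a_2^*-\sqrt\gamma\,\xi_{in,b,2}-\sqrt\kappa\,\xi_{loss,b,2},\\ \xi_{out,b,1}&=e^{i\phi_1}\big(\sqrt\gamma\,b_1+\alpha\sqrt\gamma e^{i\theta_2}b_2+\alpha e^{i\theta_2}\xi_{in,b,2}+\beta\,\xi_{BS,2}\big),\\ \xi_{out,a,2}&=e^{i\phi_2}\big(\sqrt\gamma\,a_2+\alpha\sqrt\gamma e^{i\theta_1}a_1+\alpha e^{i\theta_1}\xi_{in,a,1}+\beta\,\xi_{BS,1}\big). \end{aligned}$$ In the quadratures $a^q=a+a^*$, $a^p=(a-a^*)/i$ this reads $\dot z=Az+B\xi$, $\xi_{out}=Cz+D\xi$ with real matrices and $\xi_{out}=(\xi^q_{out,b,1},\xi^p_{out,b,1},\xi^q_{out,a,2},\xi^p_{out,a,2})^T$. Put $H=D-CA^{-1}B$, $H_1=[1\;0\;1\;0]H$, $H_2=[0\;1\;0\;{-1}]H$, and let $V_+=\mathrm{Tr}(H_1^*H_1)$, $V_-=\mathrm{Tr}(H_2^*H_2)$ be the two-mode squeezing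 spectra at frequency $0$ (vacuum inputs). The outputs are *EPR entangled* if $V_++V_-<4$. Let $V^{nops}$ be the value of $V_+$ at $\theta_1=\theta_2=\phi_1=\phi_2=0$. Let $\gamma_r=7.2\cdot10^7$, $\epsilon=x\gamma_r$, $\gamma=\gamma_r/y$ with $0<x,y\le1$, $0<\alpha\le1$, $0<\kappa\le\frac{3\cdot10^6}{\sqrt2\cdot0.6}x$ (for instance $\kappa=\frac{3\cdot 10^6}{\sqrt2\cdot0.6}x$), and assume that the network without phase shifts is stable, i.e. $A$ at $\theta_1=\theta_2=0$ is Hurwitz. Put $m=\frac{\theta_1-\theta_2}2\in(-\pi,\pi]$, $n=\frac{\theta_1+\theta_2}2$, $\phi=\phi_1+\phi_2$, and let $\phi_0=-n$ if $|m|<\frac\pi2$, $\phi_0\in\{\pi-n,-\pi-n\}$ if $m\in(-\pi,-\frac\pi2)\cup(\frac\pi2,\pi]$, and $\phi_0$ arbitrary if $m=\pm\frac\pi2$. Let $$V^{im}(m)=\begin{cases}2\dfrac{c_1+2c_2\cos m+c_3\cos 2m}{c_4-c_5\cos 2m},&|m|<\frac\pi2,\\[2mm]2\dfrac{c_1-c_3}{c_4+c_5},&m=\pm\frac\pi2,\\[2mm]2\dfrac{c_1-2c_2\cos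 m+c_3\cos 2m}{c_4-c_5\cos 2m},&\text{otherwise},\end{cases}$$ where $$\begin{aligned} c_1={}&4\alpha^4\epsilon^2\gamma^2\big(\kappa^4+8\kappa\epsilon^2\gamma+(\epsilon^2-\gamma^2)^2-2\kappa^2(\epsilon^2+\gamma^2)\big)\\ &+\alpha^2(-\kappa^2+\epsilon^2+\gamma^2)^2\big(\kappa^4+4\kappa^3\gamma-2\kappa^2(\epsilon^2-3\gamma^2)+4\kappa\gamma(\epsilon^2+\gamma^2)+\epsilon^4+2(1+2\beta^2)\epsilon^2\gamma^2+\gamma^4\big)\\ &+(\kappa^2-\epsilon^2+2\kappa\gamma+\gamma^2)^2\big(4\gamma(\kappa+\gamma)(\kappa^2+\epsilon^2+\kappa\gamma)+\beta^2(-\kappa^2+\epsilon^2+\gamma^2)^2\big),\\ c_2={}&4\alpha\epsilon\gamma(-\kappa^2+\epsilon^2+\gamma^2)(-\kappa^4-4\kappa^3\gamma-6\kappa^2\gamma^2+4\alpha^2\kappa\epsilon^2\gamma+\epsilon^4-4\kappa\gamma^3-\gamma^4),\\ c_3={}&8\alpha^2\epsilon^2\gamma^2(-\kappa+\epsilon-\gamma)(\kappa+\epsilon+\gamma)(3\kappa^2+2\kappa\gamma+\epsilon^2-\gamma^2),\\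 c_4={}&\kappa^8+8\kappa^7\gamma-4\kappa^6(\epsilon^2-7\gamma^2)-8\kappa^5(3\epsilon^2\gamma-7\gamma^3)+\kappa^4(6\epsilon^4-60\epsilon^2\gamma^2+70\gamma^4)\\ &+8\kappa^3(3\epsilon^4\gamma-10\epsilon^2\gamma^3+7\gamma^5)-4\kappa^2(\epsilon^2-7\gamma^2)(\epsilon^2-\gamma^2)^2+8\kappa\gamma(\gamma^2-\epsilon^2)^3\\ &+\epsilon^8-4\epsilon^6\gamma^2+2(3+8\alpha^4)\epsilon^4\gamma^4-4\epsilon^2\gamma^6+\gamma^8,\\ c_5={}&8\alpha^2\epsilon^2\gamma^2(\kappa^2+2\kappa\gamma-\epsilon^2+\gamma^2)^2. \end{aligned}$$ Then: 1. For every $m\in(-\pi,\pi]$ and $n$, both $V_+$ and $V_-$ equal $V^{im}(m)$ when $\phi_1+\phi_2=\phi_0$, and both are at least $V^{im}(m)$ for all $\phi_1,\phi_2$. 2. $V^{im}$ is strictly increasing on $(-\pi,-\frac\pi2]$ and on $[0,\frac\pi2]$, and strictly decreasing on $[-\frac\pi2,0]$ and on $[\frac\pi2,\pi]$. 3. On $(-\pi,\pi]$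 the minimum of $V^{im}$ is $V^{nops}=2\frac{c_1+2c_2+c_3}{c_4-c_5}$ (which is also the value of $V_-$ without phase shifts), attained exactly at $m\in\{0,\pi\}$: there the original entanglement is fully recovered. 4. On $(-\pi,\pi]$ the maximum of $V^{im}$ is $2\frac{c_1-c_3}{c_4+c_5}>2$, attained exactly at $m=\pm\frac\pi2$. 5. If the network without phase shifts is EPR entangled (i.e. $V^{nops}<2$), then the equation $V^{im}(m)=2$ has in $(-\pi,\pi]$ exactly four roots $\pm m_1,\pm m_2$, with $0<m_1<\frac\pi2<m_2<\pi$, and, with $\phi_1+\phi_2=\phi_0$, the outputs are EPR entangled if and only if $m\in(-\pi,-m_2)\cup(-m_1,m_1)\cup(m_2,\pi]$. The same holds if EPR entanglement is understood up to multiplying the two output fields by phases $e^{i\psi_1},e^{i\psi_2}$, $\psi_1,\psi_2\in(-\pi,\pi]$. -/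

import Mathlib

/-- Parameters of the dual-NOPA network: pump coupling `ε`, mirror damping rate `γ`,
amplification-loss rate `κ`, transmission rate `α` of the two paths. -/
structure NOPAParams where
  ε : ℝ
  γ : ℝ
  κ : ℝ
  α : ℝ

namespace NOPAParams

noncomputable section

/-- Reference transmissivity rate (Hz). -/
def γr : ℝ := 7.2 * 10 ^ 7

/-- Proportionality constant between the amplification-loss rate and `x = ε / γr`. -/
def κr : ℝ := 3 * 10 ^ 6 / (√2 * 0.6)

/-- Reflection rate of the beamsplitters. -/
def β (P : NOPAParams) : ℝ := √(1 - P.α ^ 2)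

/-- Multiplication by `e^{iθ}` on the quadratures `(q, p)` of a mode. -/
def rot (θ : ℝ) : Matrix (Fin 2) (Fin 2) ℝ :=
  !![Real.cos θ, -Real.sin θ; Real.sin θ, Real.cos θ]

/-- The adjoint `a ↦ a*` on the quadratures `(q, p)` of a mode. -/
def conj : Matrix (Fin 2) (Fin 2) ℝ := !![1, 0; 0, -1]

/-- A real matrix given by its `2 × 2` blocks; row `(i, 0)` is the `q`-quadrature of the `i`-th
mode or field and row `(i, 1)` its `p`-quadrature, and likewise for columns. -/
def ofBlocks {k l : ℕ} (M : Matrix (Fin k) (Fin l) (Matrix (Fin 2) (Fin 2) ℝ)) :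
    Matrix (Fin k × Fin 2) (Fin l × Fin 2) ℝ :=
  Matrix.of fun i j => M i.1 j.1 i.2 j.2

/-- Drift matrix; the modes are ordered `a₁, b₁, a₂, b₂`. -/
def A (P : NOPAParams) (θ₁ θ₂ : ℝ) : Matrix (Fin 4 × Fin 2) (Fin 4 × Fin 2) ℝ :=
  let d := (-((P.γ + P.κ) / 2)) • (1 : Matrix (Fin 2) (Fin 2) ℝ)
  let e := (P.ε / 2) • conj
  ofBlocks
    !![d, e, 0, 0;
       e, d, 0, (-(P.α * P.γ)) • rot θ₂;
       (-(P.α * P.γ)) • rot θ₁, 0, d, e;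
       0, 0, e, d]

/-- Input matrix; the ingoing fields are ordered
`in,a,1`, `in,b,2`, `loss,a,1`, `loss,b,1`, `loss,a,2`, `loss,b,2`, `BS,1`, `BS,2`. -/
def B (P : NOPAParams) (θ₁ θ₂ : ℝ) : Matrix (Fin 4 × Fin 2) (Fin 8 × Fin 2) ℝ :=
  let g := (-√P.γ) • (1 : Matrix (Fin 2) (Fin 2) ℝ)
  let k := (-√P.κ) • (1 : Matrix (Fin 2) (Fin 2) ℝ)
  let s := (-(P.β * √P.γ)) • (1 : Matrix (Fin 2) (Fin 2) ℝ)
  ofBlocks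
    !![g, 0, k, 0, 0, 0, 0, 0;
       0, (-(P.α * √P.γ)) • rot θ₂, 0, k, 0, 0, 0, s;
       (-(P.α * √P.γ)) • rot θ₁, 0, 0, 0, k, 0, s, 0;
       0, g, 0, 0, 0, k, 0, 0]

/-- Output matrix; the outgoing fields are ordered `out,b,1`, `out,a,2`. -/
def C (P : NOPAParams) (θ₁ θ₂ φ₁ φ₂ : ℝ) : Matrix (Fin 2 × Fin 2) (Fin 4 × Fin 2) ℝ :=
  ofBlocks
    !![0, √P.γ • rot φ₁, 0, (P.α * √P.γ) • rot (θ₂ + φ₁);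
       (P.α * √P.γ) • rot (θ₁ + φ₂), 0, √P.γ • rot φ₂, 0]

/-- Feedthrough matrix. -/
def D (P : NOPAParams) (θ₁ θ₂ φ₁ φ₂ : ℝ) : Matrix (Fin 2 × Fin 2) (Fin 8 × Fin 2) ℝ :=
  ofBlocks
    !![0, P.α • rot (θ₂ + φ₁), 0, 0, 0, 0, 0, P.β • rot φ₁;
       P.α • rot (θ₁ + φ₂), 0, 0, 0, 0, 0, P.β • rot φ₂, 0]

/-- A real square matrix is Hurwitz if all its complex eigenvalues have negative real part. -/
def IsHurwitz {ι : Type*} [Fintype ι] [DecidableEq ι] (M : Matrix ι ι ℝ) : Prop :=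
  ∀ z ∈ spectrum ℂ (M.map (algebraMap ℝ ℂ)), z.re < 0

/-- Transfer matrix at frequency `ω = 0`. -/
def H (P : NOPAParams) (θ₁ θ₂ φ₁ φ₂ : ℝ) : Matrix (Fin 2 × Fin 2) (Fin 8 × Fin 2) ℝ :=
  P.D θ₁ θ₂ φ₁ φ₂ - P.C θ₁ θ₂ φ₁ φ₂ * (P.A θ₁ θ₂)⁻¹ * P.B θ₁ θ₂

/-- The row `[1 0 1 0]`. -/
def rowPlus : Matrix (Fin 1) (Fin 2 × Fin 2) ℝ :=
  Matrix.of fun _ i => !![1, 0; 1, 0] i.1 i.2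

/-- The row `[0 1 0 -1]`. -/
def rowMinus : Matrix (Fin 1) (Fin 2 × Fin 2) ℝ :=
  Matrix.of fun _ i => !![0, 1; 0, -1] i.1 i.2

/-- Two-mode amplitude squeezing spectrum of two output fields with transfer matrix `T`, the
ingoing fields being in the vacuum state. -/
def specPlus (T : Matrix (Fin 2 × Fin 2) (Fin 8 × Fin 2) ℝ) : ℝ :=
  ((rowPlus * T).transpose * (rowPlus * T)).trace

/-- Two-mode phase squeezing spectrum of two output fields with transfer matrix `T`. -/
def specMinus (T : Matrix (Fin 2 × Fin 2) (Fin 8 × Fin 2) ℝ) : ℝ :=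
  ((rowMinus * T).transpose * (rowMinus * T)).trace

/-- Squeezing spectrum `V₊` at `ω = 0`. -/
def Vplus (P : NOPAParams) (θ₁ θ₂ φ₁ φ₂ : ℝ) : ℝ := specPlus (P.H θ₁ θ₂ φ₁ φ₂)

/-- Squeezing spectrum `V₋` at `ω = 0`. -/
def Vminus (P : NOPAParams) (θ₁ θ₂ φ₁ φ₂ : ℝ) : ℝ := specMinus (P.H θ₁ θ₂ φ₁ φ₂)

/-- EPR entanglement of the outgoing fields at `ω = 0` (without further rotation). -/
def EPREntangled (P : NOPAParams) (θ₁ θ₂ φ₁ φ₂ : ℝ) : Prop :=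
  P.Vplus θ₁ θ₂ φ₁ φ₂ + P.Vminus θ₁ θ₂ φ₁ φ₂ < 4

/-- EPR entanglement at `ω = 0` up to local rotations: the outgoing fields, multiplied by
`e^{iψ₁}` and `e^{iψ₂}` for some `ψ₁, ψ₂ ∈ (-π, π]`, have total squeezing spectrum below `4`.
The entanglement vanishes when this fails. -/
def EPREntangledUpToRotation (P : NOPAParams) (θ₁ θ₂ φ₁ φ₂ : ℝ) : Prop :=
  ∃ ψ₁ ∈ Set.Ioc (-Real.pi) Real.pi, ∃ ψ₂ ∈ Set.Ioc (-Real.pi) Real.pi,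
    specPlus (ofBlocks !![rot ψ₁, 0; 0, rot ψ₂] * P.H θ₁ θ₂ φ₁ φ₂) +
      specMinus (ofBlocks !![rot ψ₁, 0; 0, rot ψ₂] * P.H θ₁ θ₂ φ₁ φ₂) < 4

/-- The spectrum `V₊` of the network without phase shifts. -/
def Vnops (P : NOPAParams) : ℝ := P.Vplus 0 0 0 0

def c₁ (P : NOPAParams) : ℝ :=
  4 * P.α ^ 4 * P.ε ^ 2 * P.γ ^ 2 *
      (P.κ ^ 4 + 8 * P.κ * P.ε ^ 2 * P.γ + (P.ε ^ 2 - P.γ ^ 2) ^ 2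
        - 2 * P.κ ^ 2 * (P.ε ^ 2 + P.γ ^ 2))
    + P.α ^ 2 * (-P.κ ^ 2 + P.ε ^ 2 + P.γ ^ 2) ^ 2 *
      (P.κ ^ 4 + 4 * P.κ ^ 3 * P.γ - 2 * P.κ ^ 2 * (P.ε ^ 2 - 3 * P.γ ^ 2)
        + 4 * P.κ * P.γ * (P.ε ^ 2 + P.γ ^ 2) + P.ε ^ 4
        + 2 * (1 + 2 * P.β ^ 2) * P.ε ^ 2 * P.γ ^ 2 + P.γ ^ 4)
    + (P.κ ^ 2 - P.ε ^ 2 + 2 * P.κ * P.γ + P.γ ^ 2) ^ 2 *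
      (4 * P.γ * (P.κ + P.γ) * (P.κ ^ 2 + P.ε ^ 2 + P.κ * P.γ)
        + P.β ^ 2 * (-P.κ ^ 2 + P.ε ^ 2 + P.γ ^ 2) ^ 2)

def c₂ (P : NOPAParams) : ℝ :=
  4 * P.α * P.ε * P.γ * (-P.κ ^ 2 + P.ε ^ 2 + P.γ ^ 2) *
    (-P.κ ^ 4 - 4 * P.κ ^ 3 * P.γ - 6 * P.κ ^ 2 * P.γ ^ 2
      + 4 * P.α ^ 2 * P.κ * P.ε ^ 2 * P.γ + P.ε ^ 4 - 4 * P.κ * P.γ ^ 3 - P.γ ^ 4)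

def c₃ (P : NOPAParams) : ℝ :=
  8 * P.α ^ 2 * P.ε ^ 2 * P.γ ^ 2 * (-P.κ + P.ε - P.γ) * (P.κ + P.ε + P.γ) *
    (3 * P.κ ^ 2 + 2 * P.κ * P.γ + P.ε ^ 2 - P.γ ^ 2)

def c₄ (P : NOPAParams) : ℝ :=
  P.κ ^ 8 + 8 * P.κ ^ 7 * P.γ - 4 * P.κ ^ 6 * (P.ε ^ 2 - 7 * P.γ ^ 2)
    - 8 * P.κ ^ 5 * (3 * P.ε ^ 2 * P.γ - 7 * P.γ ^ 3)
    + P.κ ^ 4 * (6 * P.ε ^ 4 - 60 * P.ε ^ 2 * P.γ ^ 2 + 70 * P.γ ^ 4)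
    + 8 * P.κ ^ 3 * (3 * P.ε ^ 4 * P.γ - 10 * P.ε ^ 2 * P.γ ^ 3 + 7 * P.γ ^ 5)
    - 4 * P.κ ^ 2 * (P.ε ^ 2 - 7 * P.γ ^ 2) * (P.ε ^ 2 - P.γ ^ 2) ^ 2
    + 8 * P.κ * P.γ * (-P.ε ^ 2 + P.γ ^ 2) ^ 3
    + P.ε ^ 8 - 4 * P.ε ^ 6 * P.γ ^ 2 + 2 * (3 + 8 * P.α ^ 4) * P.ε ^ 4 * P.γ ^ 4
    - 4 * P.ε ^ 2 * P.γ ^ 6 + P.γ ^ 8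

def c₅ (P : NOPAParams) : ℝ :=
  8 * P.α ^ 2 * P.ε ^ 2 * P.γ ^ 2 * (P.κ ^ 2 + 2 * P.κ * P.γ - P.ε ^ 2 + P.γ ^ 2) ^ 2

/-- `φ = φ₁ + φ₂` is a choice of the optimal output phase `φ₀` for `m = (θ₁ - θ₂) / 2` and
`n = (θ₁ + θ₂) / 2`. At `m = ±π/2` every `φ` qualifies. -/
def IsOptimalPhase (m n φ : ℝ) : Prop :=
  (m ∈ Set.Ioo (-(Real.pi / 2)) (Real.pi / 2) → φ = -n) ∧
  (m ∈ Set.Ioo (-Real.pi) (-(Real.pi / 2)) ∪ Set.Ioc (Real.pi / 2) Real.pi →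
    φ = Real.pi - n ∨ φ = -Real.pi - n)

open Classical in
/-- The improved spectrum `V^{im}` as a function of `m ∈ (-π, π]`. -/
def Vim (P : NOPAParams) (m : ℝ) : ℝ :=
  if m ∈ Set.Ioo (-(Real.pi / 2)) (Real.pi / 2) then
    2 * ((P.c₁ + 2 * P.c₂ * Real.cos m + P.c₃ * Real.cos (2 * m)) /
      (P.c₄ - P.c₅ * Real.cos (2 * m)))
  else if m = Real.pi / 2 ∨ m = -(Real.pi / 2) then
    2 * ((P.c₁ - P.c₃) / (P.c₄ + P.c₅))
  else
    2 * ((P.c₁ - 2 * P.c₂ * Real.cos m + P.c₃ * Real.cos (2 * m)) /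
      (P.c₄ - P.c₅ * Real.cos (2 * m)))

end

end NOPAParams

namespace NOPAParams

/-! In the variables $a_1,b_1^*,a_2,b_2^*$ the dynamics is complex linear, so a real row on the
eight quadratures is a quadruple of complex numbers (`modeRow`), and $V_+$ follows from the row $y$
with $yA=[1\,0\,1\,0]C$. Inverting each amplifier's own $2\times2$ block leaves two scalar unknowns
$r,r'$ that feed each other around the loop, each pass having gain $g=$ `loopGain`. Stability
without phase shifts gives $g<1$; phase shifts do not change moduli, so $A$ is invertible for all of
them (`Stable.isUnit_det_A`).

Solving for $r,r'$ gives `Stable.Vplus_eq`: for fixed $m$ the spectrum is affine in $\cos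
m\cos(n+\phi)$ with slope of the sign of $c_2$. $V_-$ is $V_+$ with opposite quarter turns at the
outputs, which preserve $\phi$, so the two spectra agree. As $c_2<0$ (`Stable.c₂_neg`), the best
phase replaces the product by $t=|\cos m|$.

As a function of $t$, numerator and denominator share the factor $1+g^2-2gt$. What remains is a
Möbius function plus a constant (`Stable.profile_eq`), strictly decreasing on $[0,1]$; monotonicity
and both extrema follow from the shape of $|\cos m|$. An explicit positive expression shows that the
value at $t=0$ exceeds $2$ (`Stable.two_lt_profile_zero`), so when the value at $t=1$ is below $2$
there is one crossing in $t$, hence four in $m$. -/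

/-! ### Block matrices and local phase shifts of the outputs -/

theorem ofBlocks_mul {k l r : ℕ} (M : Matrix (Fin k) (Fin l) (Matrix (Fin 2) (Fin 2) ℝ))
    (N : Matrix (Fin l) (Fin r) (Matrix (Fin 2) (Fin 2) ℝ)) :
    ofBlocks M * ofBlocks N = ofBlocks (M * N) := by
  ext i j
  simp [ofBlocks, Matrix.mul_apply, Fintype.sum_prod_type, Matrix.sum_apply]

theorem rot_mul_rot (a b : ℝ) : rot a * rot b = rot (b + a) := by
  ext i j
  fin_cases i <;> fin_cases j <;>
    simp [rot, Matrix.mul_apply, Real.cos_add, Real.sin_add] <;> ring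

/-- Local phase shifts `ψ₁`, `ψ₂` on the two outgoing fields. -/
noncomputable def phaseRot (ψ₁ ψ₂ : ℝ) : Matrix (Fin 2 × Fin 2) (Fin 2 × Fin 2) ℝ :=
  ofBlocks !![rot ψ₁, 0; 0, rot ψ₂]

theorem phaseRot_mul_C (P : NOPAParams) (θ₁ θ₂ φ₁ φ₂ ψ₁ ψ₂ : ℝ) :
    phaseRot ψ₁ ψ₂ * P.C θ₁ θ₂ φ₁ φ₂ = P.C θ₁ θ₂ (φ₁ + ψ₁) (φ₂ + ψ₂) := by
  rw [phaseRot, C, ofBlocks_mul, C]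
  congr 1
  ext1 i j
  fin_cases i <;> fin_cases j <;>
    simp [Matrix.mul_apply, Fin.sum_univ_two, rot_mul_rot, add_assoc]

theorem phaseRot_mul_D (P : NOPAParams) (θ₁ θ₂ φ₁ φ₂ ψ₁ ψ₂ : ℝ) :
    phaseRot ψ₁ ψ₂ * P.D θ₁ θ₂ φ₁ φ₂ = P.D θ₁ θ₂ (φ₁ + ψ₁) (φ₂ + ψ₂) := by
  rw [phaseRot, D, ofBlocks_mul, D]
  congr 1
  ext1 i j
  fin_cases i <;> fin_cases j <;>
    simp [Matrix.mul_apply, Fin.sum_univ_two, rot_mul_rot, add_assoc]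

theorem phaseRot_mul_H (P : NOPAParams) (θ₁ θ₂ φ₁ φ₂ ψ₁ ψ₂ : ℝ) :
    phaseRot ψ₁ ψ₂ * P.H θ₁ θ₂ φ₁ φ₂ = P.H θ₁ θ₂ (φ₁ + ψ₁) (φ₂ + ψ₂) := by
  rw [H, Matrix.mul_sub, phaseRot_mul_D, ← Matrix.mul_assoc, ← Matrix.mul_assoc, phaseRot_mul_C, H]

/-- The entry of a block, kept folded so that a block matrix is first evaluated to a block. -/
def blockEntry (N : Matrix (Fin 2) (Fin 2) ℝ) (a b : Fin 2) : ℝ := N a b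

theorem ofBlocks_apply {k l : ℕ} (M : Matrix (Fin k) (Fin l) (Matrix (Fin 2) (Fin 2) ℝ))
    (i : Fin k) (a : Fin 2) (j : Fin l) (b : Fin 2) :
    ofBlocks M (i, a) (j, b) = blockEntry (M i j) a b := rfl

@[simp] theorem blockEntry_zero (a b : Fin 2) : blockEntry 0 a b = 0 := rfl

@[simp] theorem blockEntry_smul (c : ℝ) (N : Matrix (Fin 2) (Fin 2) ℝ) (a b : Fin 2) :
    blockEntry (c • N) a b = c * blockEntry N a b := rfl

@[simp] theorem blockEntry_neg (N : Matrix (Fin 2) (Fin 2) ℝ) (a b : Fin 2) :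
    blockEntry (-N) a b = -blockEntry N a b := rfl

@[simp] theorem blockEntry_one_zero_zero : blockEntry 1 0 0 = 1 := rfl
@[simp] theorem blockEntry_one_zero_one : blockEntry 1 0 1 = 0 := rfl
@[simp] theorem blockEntry_one_one_zero : blockEntry 1 1 0 = 0 := rfl
@[simp] theorem blockEntry_one_one_one : blockEntry 1 1 1 = 1 := rfl
@[simp] theorem blockEntry_conj_zero_zero : blockEntry conj 0 0 = 1 := rfl
@[simp] theorem blockEntry_conj_zero_one : blockEntry conj 0 1 = 0 := rfl
@[simp] theorem blockEntry_conj_one_zero : blockEntry conj 1 0 = 0 := rfl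
@[simp] theorem blockEntry_conj_one_one : blockEntry conj 1 1 = -1 := rfl
@[simp] theorem blockEntry_rot_zero_zero (θ : ℝ) : blockEntry (rot θ) 0 0 = Real.cos θ := rfl
@[simp] theorem blockEntry_rot_zero_one (θ : ℝ) : blockEntry (rot θ) 0 1 = -Real.sin θ := rfl
@[simp] theorem blockEntry_rot_one_zero (θ : ℝ) : blockEntry (rot θ) 1 0 = Real.sin θ := rfl
@[simp] theorem blockEntry_rot_one_one (θ : ℝ) : blockEntry (rot θ) 1 1 = Real.cos θ := rfl

/-- Opposite quarter turns carry the $q$-sum to the $p$-difference; this reduces every statement on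
$V_-$ to one on $V_+$. -/
theorem rowMinus_eq : rowMinus = rowPlus * phaseRot (-(Real.pi / 2)) (Real.pi / 2) := by
  ext i ⟨j, l⟩
  fin_cases j <;> fin_cases l <;>
    simp [rowMinus, rowPlus, phaseRot, ofBlocks_apply, Matrix.mul_apply, Fintype.sum_prod_type]

theorem specMinus_eq (T : Matrix (Fin 2 × Fin 2) (Fin 8 × Fin 2) ℝ) :
    specMinus T = specPlus (phaseRot (-(Real.pi / 2)) (Real.pi / 2) * T) := by
  rw [specMinus, specPlus, rowMinus_eq, Matrix.mul_assoc]

theorem Vminus_eq_Vplus (P : NOPAParams) (θ₁ θ₂ φ₁ φ₂ : ℝ) :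
    P.Vminus θ₁ θ₂ φ₁ φ₂ = P.Vplus θ₁ θ₂ (φ₁ + -(Real.pi / 2)) (φ₂ + Real.pi / 2) := by
  rw [Vminus, specMinus_eq, phaseRot_mul_H, Vplus]

/-! ### From the Hurwitz condition to a gain bound -/

/-- Stability of the network without phase shifts bounds the total gain. -/
theorem gain_lt_of_isHurwitz (P : NOPAParams) (hε : 0 < P.ε) (hγ : 0 < P.γ) (hα : 0 < P.α)
    (h : IsHurwitz (P.A 0 0)) : P.ε ^ 2 + 2 * P.α * P.ε * P.γ < (P.γ + P.κ) ^ 2 := by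
  set r : ℝ := √(P.ε ^ 2 + 2 * P.α * P.ε * P.γ) with hr
  have hr2 : r ^ 2 = P.ε ^ 2 + 2 * P.α * P.ε * P.γ := Real.sq_sqrt (by positivity)
  have hr0 : 0 ≤ r := Real.sqrt_nonneg _
  suffices hlt : r < P.γ + P.κ by
    rw [← hr2]
    exact pow_lt_pow_left₀ hlt hr0 two_ne_zero
  let l : ℝ := (r - (P.γ + P.κ)) / 2
  -- Antisymmetric under exchange of the two amplifiers, so that the coupling $-\alpha\gamma$ acts
  -- as positive feedback. This yields the real eigenvalue $l$, whose negativity is the claimed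
  -- bound.
  let v : Fin 4 × Fin 2 → ℝ := fun i => !![P.ε, 0; r, 0; -r, 0; -P.ε, 0] i.1 i.2
  have hv : (P.A 0 0).mulVec v = l • v := by
    ext ⟨i, j⟩
    fin_cases i <;> fin_cases j <;>
      simp [A, ofBlocks_apply, v, l, Matrix.mulVec, dotProduct, Fintype.sum_prod_type,
        Fin.sum_univ_four] <;> try linarith
  have hmem : (l : ℂ) ∈ spectrum ℂ ((P.A 0 0).map (algebraMap ℝ ℂ)) := by
    rw [← Matrix.spectrum_toLin']
    refine Module.End.HasEigenvalue.mem_spectrum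
      (Module.End.hasEigenvalue_of_hasEigenvector (x := fun i => (v i : ℂ)) ⟨?_, ?_⟩)
    · rw [Module.End.mem_eigenspace_iff, Matrix.toLin'_apply]
      ext i
      have := congrArg (fun w => ((w i : ℝ) : ℂ)) hv
      simpa [Matrix.mulVec, dotProduct] using this
    · intro h0
      have := congrFun h0 (0, 0)
      simp [v, hε.ne'] at this
  have := h _ hmem
  simp [l] at this
  linarith

/-! ### Complex coordinates for rows on quadratures -/

/-- The phase factor `e^{iθ}`. -/
noncomputable def cis (θ : ℝ) : ℂ := ⟨Real.cos θ, Real.sin θ⟩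

@[simp] theorem cis_re (θ : ℝ) : (cis θ).re = Real.cos θ := rfl
@[simp] theorem cis_im (θ : ℝ) : (cis θ).im = Real.sin θ := rfl

theorem cis_add (a b : ℝ) : cis (a + b) = cis a * cis b := by
  apply Complex.ext <;> simp [Real.cos_add, Real.sin_add] <;> ring

theorem cis_zero : cis 0 = 1 := by
  apply Complex.ext <;> simp

theorem normSq_cis (θ : ℝ) : Complex.normSq (cis θ) = 1 := by
  rw [Complex.normSq_apply, cis_re, cis_im]
  linarith [Real.cos_sq_add_sin_sq θ]

/-- The coordinates on quadratures of `Re (y₀ a₁ + y₁ b₁* + y₂ a₂ + y₃ b₂*)`. -/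
def modeRow (y₀ y₁ y₂ y₃ : ℂ) : Matrix (Fin 1) (Fin 4 × Fin 2) ℝ :=
  Matrix.of fun _ i => !![y₀.re, -y₀.im; y₁.re, y₁.im; y₂.re, -y₂.im; y₃.re, y₃.im] i.1 i.2

theorem modeRow_mul_A (P : NOPAParams) (θ₁ θ₂ : ℝ) (y₀ y₁ y₂ y₃ : ℂ) :
    modeRow y₀ y₁ y₂ y₃ * P.A θ₁ θ₂ = modeRow
      (-((P.γ + P.κ) / 2 : ℝ) * y₀ + (P.ε / 2 : ℝ) * y₁ - (P.α * P.γ : ℝ) * cis θ₁ * y₂)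
      ((P.ε / 2 : ℝ) * y₀ - ((P.γ + P.κ) / 2 : ℝ) * y₁)
      (-((P.γ + P.κ) / 2 : ℝ) * y₂ + (P.ε / 2 : ℝ) * y₃)
      (-((P.α * P.γ : ℝ) * cis (-θ₂) * y₁) + (P.ε / 2 : ℝ) * y₂ -
        ((P.γ + P.κ) / 2 : ℝ) * y₃) := by
  ext _ ⟨j, l⟩
  fin_cases j <;> fin_cases l <;>
    simp [A, ofBlocks_apply, modeRow, Matrix.mul_apply, Fintype.sum_prod_type,
      Fin.sum_univ_four, -Complex.ofReal_div, -Complex.ofReal_mul, -Complex.ofReal_add] <;> ring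

theorem rowPlus_mul_C (P : NOPAParams) (θ₁ θ₂ φ₁ φ₂ : ℝ) :
    rowPlus * P.C θ₁ θ₂ φ₁ φ₂ = modeRow ((P.α * √P.γ : ℝ) * cis (θ₁ + φ₂)) ((√P.γ : ℝ) * cis (-φ₁))
      ((√P.γ : ℝ) * cis φ₂) ((P.α * √P.γ : ℝ) * cis (-(θ₂ + φ₁))) := by
  ext _ ⟨j, l⟩
  fin_cases j <;> fin_cases l <;>
    simp [C, ofBlocks_apply, modeRow, rowPlus, Matrix.mul_apply, Fintype.sum_prod_type,
      -Complex.ofReal_mul, -neg_add_rev]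

theorem specPlus_eq_sum (T : Matrix (Fin 2 × Fin 2) (Fin 8 × Fin 2) ℝ) :
    specPlus T = ∑ j, (rowPlus * T) 0 j ^ 2 := by
  simp only [specPlus, Matrix.trace, Matrix.diag_apply, Matrix.mul_apply (M := Matrix.transpose _),
    Matrix.transpose_apply, Fin.sum_univ_one, sq]

/-- The coordinates on quadratures of the real part of a combination of the ingoing fields, the
fields entering through `b`-modes being conjugated. -/
def fieldRow (w : Fin 8 → ℂ) : Matrix (Fin 1) (Fin 8 × Fin 2) ℝ :=
  Matrix.of fun _ i => !![(w 0).re, -(w 0).im; (w 1).re, (w 1).im; (w 2).re, -(w 2).im;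
    (w 3).re, (w 3).im; (w 4).re, -(w 4).im; (w 5).re, (w 5).im; (w 6).re, -(w 6).im;
    (w 7).re, (w 7).im] i.1 i.2

theorem sum_fieldRow_sq (w : Fin 8 → ℂ) :
    ∑ j, fieldRow w 0 j ^ 2 = ∑ k, Complex.normSq (w k) := by
  simp only [Fintype.sum_prod_type, Fin.sum_univ_two, Fin.sum_univ_eight, Complex.normSq_apply]
  simp [fieldRow]
  ring

theorem rowPlus_mul_D_sub (P : NOPAParams) (θ₁ θ₂ φ₁ φ₂ : ℝ) (y₀ y₁ y₂ y₃ : ℂ) :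
    rowPlus * P.D θ₁ θ₂ φ₁ φ₂ - modeRow y₀ y₁ y₂ y₃ * P.B θ₁ θ₂ = fieldRow
      ![(P.α : ℝ) * cis (θ₁ + φ₂) + (√P.γ : ℝ) * y₀ + (P.α * √P.γ : ℝ) * cis θ₁ * y₂,
        (P.α : ℝ) * cis (-(θ₂ + φ₁)) + (P.α * √P.γ : ℝ) * cis (-θ₂) * y₁ + (√P.γ : ℝ) * y₃,
        (√P.κ : ℝ) * y₀, (√P.κ : ℝ) * y₁, (√P.κ : ℝ) * y₂, (√P.κ : ℝ) * y₃,
        (P.β : ℝ) * cis φ₂ + (P.β * √P.γ : ℝ) * y₂,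
        (P.β : ℝ) * cis (-φ₁) + (P.β * √P.γ : ℝ) * y₁] := by
  ext _ ⟨j, l⟩
  fin_cases j <;> fin_cases l <;>
    simp [B, D, ofBlocks_apply, modeRow, fieldRow, rowPlus, Matrix.mul_apply,
      Fintype.sum_prod_type, Fin.sum_univ_four, -Complex.ofReal_mul, -neg_add_rev] <;> ring

/-- Replaces inverting $A$ by exhibiting a solution $y$ of one linear system. -/
theorem Vplus_eq_of_modeRow_mul_A (P : NOPAParams) (θ₁ θ₂ φ₁ φ₂ : ℝ) (hA : IsUnit (P.A θ₁ θ₂).det)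
    (y₀ y₁ y₂ y₃ : ℂ) (h : modeRow y₀ y₁ y₂ y₃ * P.A θ₁ θ₂ = rowPlus * P.C θ₁ θ₂ φ₁ φ₂) :
    P.Vplus θ₁ θ₂ φ₁ φ₂ =
      ∑ j, (rowPlus * P.D θ₁ θ₂ φ₁ φ₂ - modeRow y₀ y₁ y₂ y₃ * P.B θ₁ θ₂) 0 j ^ 2 := by
  have : rowPlus * P.H θ₁ θ₂ φ₁ φ₂ =
      rowPlus * P.D θ₁ θ₂ φ₁ φ₂ - modeRow y₀ y₁ y₂ y₃ * P.B θ₁ θ₂ := by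
    rw [H, Matrix.mul_sub, ← Matrix.mul_assoc, ← Matrix.mul_assoc, ← h,
      Matrix.mul_nonsing_inv_cancel_right _ _ hA]
  rw [Vplus, specPlus_eq_sum, this]

theorem norm_cis (θ : ℝ) : ‖cis θ‖ = 1 := by
  rw [← sq_eq_sq₀ (norm_nonneg _) zero_le_one, ← Complex.normSq_eq_norm_sq, normSq_cis, one_pow]

theorem cis_mul_cis_neg (θ : ℝ) : cis θ * cis (-θ) = 1 := by
  rw [← cis_add, add_neg_cancel, cis_zero]

theorem modeRow_inj {y₀ y₁ y₂ y₃ z₀ z₁ z₂ z₃ : ℂ}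
    (h : modeRow y₀ y₁ y₂ y₃ = modeRow z₀ z₁ z₂ z₃) :
    y₀ = z₀ ∧ y₁ = z₁ ∧ y₂ = z₂ ∧ y₃ = z₃ := by
  have h' := fun i j => congrFun (congrFun h 0) (i, j)
  refine ⟨Complex.ext (h' 0 0) ?_, Complex.ext (h' 1 0) (h' 1 1), Complex.ext (h' 2 0) ?_,
    Complex.ext (h' 3 0) (h' 3 1)⟩
  · exact neg_injective (h' 0 1)
  · exact neg_injective (h' 2 1)

theorem exists_eq_modeRow (v : Matrix (Fin 1) (Fin 4 × Fin 2) ℝ) :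
    ∃ y₀ y₁ y₂ y₃ : ℂ, v = modeRow y₀ y₁ y₂ y₃ := by
  refine ⟨⟨v 0 (0, 0), -v 0 (0, 1)⟩, ⟨v 0 (1, 0), v 0 (1, 1)⟩, ⟨v 0 (2, 0), -v 0 (2, 1)⟩,
    ⟨v 0 (3, 0), v 0 (3, 1)⟩, ?_⟩
  ext i ⟨j, l⟩
  fin_cases i
  fin_cases j <;> fin_cases l <;> simp [modeRow]

theorem modeRow_zero : modeRow 0 0 0 0 = 0 := by
  ext _ ⟨j, l⟩
  fin_cases j <;> fin_cases l <;> simp [modeRow]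

/-! ### Gains of one amplifier and the loop equations -/

/-- Four times the determinant of the drift of an uncoupled amplifier. -/
def gap (P : NOPAParams) : ℝ := (P.γ + P.κ) ^ 2 - P.ε ^ 2

/-- Direct gain of a single amplifier at zero frequency. -/
noncomputable def dirGain (P : NOPAParams) : ℝ := (P.κ ^ 2 - P.γ ^ 2 - P.ε ^ 2) / P.gap

/-- Cross gain of a single amplifier at zero frequency. -/
noncomputable def crossGain (P : NOPAParams) : ℝ := 2 * P.γ * P.ε / P.gap

/-- Gain of one path followed by one amplifier; the round-trip gain is its square. -/
noncomputable def loopGain (P : NOPAParams) : ℝ := P.α * P.crossGain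

/-- Positivity of the parameters, and stability of the network without phase shifts. -/
structure Stable (P : NOPAParams) : Prop where
  ε_pos : 0 < P.ε
  γ_pos : 0 < P.γ
  κ_pos : 0 < P.κ
  α_pos : 0 < P.α
  α_le_one : P.α ≤ 1
  stable : P.ε ^ 2 + 2 * P.α * P.ε * P.γ < (P.γ + P.κ) ^ 2

namespace Stable

theorem gap_gt {P : NOPAParams} (h : P.Stable) : 2 * P.α * P.ε * P.γ < P.gap := by
  have := h.stable
  unfold gap
  linarith

theorem gap_pos {P : NOPAParams} (h : P.Stable) : 0 < P.gap := by
  have := h.ε_pos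
  have := h.γ_pos
  have := h.α_pos
  exact lt_trans (by positivity) h.gap_gt

theorem crossGain_pos {P : NOPAParams} (h : P.Stable) : 0 < P.crossGain := by
  have := h.ε_pos
  have := h.γ_pos
  have := h.gap_pos
  unfold crossGain
  positivity

theorem loopGain_pos {P : NOPAParams} (h : P.Stable) : 0 < P.loopGain :=
  mul_pos h.α_pos h.crossGain_pos

theorem loopGain_lt_one {P : NOPAParams} (h : P.Stable) : P.loopGain < 1 := by
  have := h.gap_gt
  unfold loopGain crossGain
  rw [← mul_div_assoc, div_lt_one h.gap_pos]
  linarith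

/-- For a row in the left kernel, eliminating $y_0$ and $y_3$ gives $|y_1|=g|y_2|$ and
$|y_2|=g|y_1|$, which forces both to vanish because $g<1$. -/
theorem isUnit_det_A {P : NOPAParams} (h : P.Stable) (θ₁ θ₂ : ℝ) : IsUnit (P.A θ₁ θ₂).det := by
  rw [isUnit_iff_ne_zero]
  intro hdet
  obtain ⟨v, hv0, hv⟩ := Matrix.exists_vecMul_eq_zero_iff.2 hdet
  obtain ⟨y₀, y₁, y₂, y₃, hy⟩ := exists_eq_modeRow (Matrix.of fun _ => v)
  have hvA : (Matrix.of fun _ => v : Matrix (Fin 1) (Fin 4 × Fin 2) ℝ) * P.A θ₁ θ₂ = 0 := by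
    ext i j
    exact congrFun hv j
  rw [hy, modeRow_mul_A, ← modeRow_zero] at hvA
  obtain ⟨e₀, e₁, e₂, e₃⟩ := modeRow_inj hvA
  have hS : (P.gap : ℂ) ≠ 0 := by exact_mod_cast h.gap_pos.ne'
  have hSv : (P.gap : ℂ) = (P.γ + P.κ) ^ 2 - P.ε ^ 2 := by simp [gap]
  have hgS : (P.gap : ℂ) * P.loopGain = 2 * P.α * P.γ * P.ε := by
    rw [loopGain, crossGain]
    push_cast
    field_simp
  push_cast at e₀ e₁ e₂ e₃
  have f₁ : y₁ = -(P.loopGain * cis θ₁ * y₂) := by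
    apply mul_left_cancel₀ hS
    linear_combination (-2 * P.ε) * e₀ - 2 * (P.γ + P.κ) * e₁ + cis θ₁ * y₂ * hgS + y₁ * hSv
  have f₂ : y₂ = -(P.loopGain * cis (-θ₂) * y₁) := by
    apply mul_left_cancel₀ hS
    linear_combination (-2 * P.ε) * e₃ - 2 * (P.γ + P.κ) * e₂ + cis (-θ₂) * y₁ * hgS + y₂ * hSv
  have n₁ : ‖y₁‖ = P.loopGain * ‖y₂‖ := by
    conv_lhs => rw [f₁]
    simp [norm_cis, abs_of_pos h.loopGain_pos]
  have n₂ : ‖y₂‖ = P.loopGain * ‖y₁‖ := by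
    conv_lhs => rw [f₂]
    simp [norm_cis, abs_of_pos h.loopGain_pos]
  have hg := h.loopGain_lt_one
  have hg0 := h.loopGain_pos
  have z₁ : y₁ = 0 := by
    rw [← norm_eq_zero]
    nlinarith [norm_nonneg y₁, norm_nonneg y₂]
  have z₂ : y₂ = 0 := by rw [f₂, z₁, mul_zero, neg_zero]
  have hε : (P.ε : ℂ) ≠ 0 := by exact_mod_cast h.ε_pos.ne'
  have z₀ : y₀ = 0 := by
    apply mul_left_cancel₀ hε
    linear_combination 2 * e₁ + (P.γ + P.κ) * z₁
  have z₃ : y₃ = 0 := by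
    apply mul_left_cancel₀ hε
    linear_combination 2 * e₂ + (P.γ + P.κ) * z₂
  apply hv0
  rw [z₀, z₁, z₂, z₃, modeRow_zero] at hy
  exact congrFun hy 0

/-- With the feedback from the other amplifier included, the row entering amplifier 1 is
$\sqrt\gamma\,e^{-i\phi_1}(r,1)$ on $(a_1,b_1^*)$, and the one entering amplifier 2 is
$\sqrt\gamma\,e^{i\phi_2}(1,r')$ on $(a_2,b_2^*)$. The hypotheses say that these are consistent. The
three groups of terms come from the direct inputs, the loss channels and the beamsplitters. -/
theorem Vplus_eq_of_loop {P : NOPAParams} (h : P.Stable) (θ₁ θ₂ φ₁ φ₂ : ℝ) (r r' : ℂ)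
    (hr : cis (-φ₁) * r = P.α * cis θ₁ * cis φ₂ * (P.dirGain - P.crossGain * r'))
    (hr' : cis φ₂ * r' = P.α * cis (-θ₂) * cis (-φ₁) * (P.dirGain - P.crossGain * r)) :
    P.Vplus θ₁ θ₂ φ₁ φ₂ =
      Complex.normSq (P.dirGain * r - P.crossGain) + Complex.normSq (P.dirGain * r' - P.crossGain)
      + 4 * P.κ * P.γ / P.gap ^ 2 *
        (Complex.normSq ((P.γ + P.κ) * r + P.ε) + Complex.normSq (P.ε * r + (P.γ + P.κ))
          + Complex.normSq ((P.γ + P.κ) * r' + P.ε) + Complex.normSq (P.ε * r' + (P.γ + P.κ)))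
      + (1 - P.α ^ 2) * (Complex.normSq (P.dirGain - P.crossGain * r)
          + Complex.normSq (P.dirGain - P.crossGain * r')) := by
  have hS : (P.gap : ℂ) ≠ 0 := by exact_mod_cast h.gap_pos.ne'
  have hSv : (P.gap : ℂ) = (P.γ + P.κ) ^ 2 - P.ε ^ 2 := by simp [gap]
  have hτ : (P.crossGain : ℂ) * P.gap = 2 * P.γ * P.ε := by
    rw [crossGain]
    push_cast
    field_simp
  have hσ : (P.dirGain : ℂ) * P.gap = P.gap - 2 * P.γ * (P.γ + P.κ) := by
    rw [dirGain]
    push_cast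
    field_simp
    rw [hSv]
    ring
  have hγ2 : ((√P.γ : ℝ) : ℂ) ^ 2 = P.γ := by
    exact_mod_cast Real.sq_sqrt h.γ_pos.le
  have hβ2 : P.β ^ 2 = 1 - P.α ^ 2 :=
    Real.sq_sqrt (by nlinarith [h.α_pos, h.α_le_one])
  -- The inverse of one amplifier's block is $-2/\mathrm{gap}$ times the matrix with $\gamma+\kappa$
  -- on the diagonal and $\epsilon$ off it; the other factor $\sqrt\gamma$ is from $C$.
  set c : ℝ := -(2 * √P.γ / P.gap) with hc
  have hcS : (c : ℂ) * P.gap = -(2 * (√P.γ : ℝ)) := by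
    rw [hc]
    push_cast
    field_simp
  have hcγ : ((√P.γ : ℝ) : ℂ) * c * P.gap = -(2 * P.γ) := by
    linear_combination ((√P.γ : ℝ) : ℂ) * hcS - 2 * hγ2
  have hc2 : Complex.normSq c = 4 * P.γ / P.gap ^ 2 := by
    rw [Complex.normSq_ofReal, hc]
    have := h.gap_pos.ne'
    field_simp
    rw [Real.sq_sqrt h.γ_pos.le]
    ring
  set p := cis φ₂
  set q := cis (-φ₁)
  have hp1 : Complex.normSq p = 1 := normSq_cis _
  have hq1 : Complex.normSq q = 1 := normSq_cis _
  rw [P.Vplus_eq_of_modeRow_mul_A θ₁ θ₂ φ₁ φ₂ (h.isUnit_det_A θ₁ θ₂)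
    (c * q * ((P.γ + P.κ) * r + P.ε)) (c * q * (P.ε * r + (P.γ + P.κ)))
    (c * p * (P.ε * r' + (P.γ + P.κ))) (c * p * ((P.γ + P.κ) * r' + P.ε)) ?_,
    rowPlus_mul_D_sub, sum_fieldRow_sq, Fin.sum_univ_eight]
  · have w0 : (P.α : ℝ) * cis (θ₁ + φ₂) + (√P.γ : ℝ) * (c * q * ((P.γ + P.κ) * r + P.ε)) +
        (P.α * √P.γ : ℝ) * cis θ₁ * (c * p * (P.ε * r' + (P.γ + P.κ))) =
        q * (P.dirGain * r - P.crossGain) := by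
      rw [cis_add]
      apply mul_left_cancel₀ hS
      push_cast
      linear_combination (q * ((P.γ + P.κ) * r + P.ε) +
        P.α * cis θ₁ * p * (P.ε * r' + (P.γ + P.κ))) * hcγ - P.gap * hr
        - (P.α * cis θ₁ * p + q * r) * hσ + (P.α * cis θ₁ * p * r' + q) * hτ
    have w1 : (P.α : ℝ) * cis (-(θ₂ + φ₁)) +
        (P.α * √P.γ : ℝ) * cis (-θ₂) * (c * q * (P.ε * r + (P.γ + P.κ))) +
        (√P.γ : ℝ) * (c * p * ((P.γ + P.κ) * r' + P.ε)) =
        p * (P.dirGain * r' - P.crossGain) := by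
      rw [neg_add, cis_add]
      apply mul_left_cancel₀ hS
      push_cast
      linear_combination (p * ((P.γ + P.κ) * r' + P.ε) +
        P.α * cis (-θ₂) * q * (P.ε * r + (P.γ + P.κ))) * hcγ - P.gap * hr'
        - (P.α * cis (-θ₂) * q + p * r') * hσ + (P.α * cis (-θ₂) * q * r + p) * hτ
    have w6 : (P.β : ℝ) * p + (P.β * √P.γ : ℝ) * (c * p * (P.ε * r' + (P.γ + P.κ))) =
        P.β * p * (P.dirGain - P.crossGain * r') := by
      apply mul_left_cancel₀ hS
      push_cast
      linear_combination P.β * p * (P.ε * r' + (P.γ + P.κ)) * hcγ - P.β * p * hσ + P.β * p * r' * hτ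
    have w7 : (P.β : ℝ) * q + (P.β * √P.γ : ℝ) * (c * q * (P.ε * r + (P.γ + P.κ))) =
        P.β * q * (P.dirGain - P.crossGain * r) := by
      apply mul_left_cancel₀ hS
      push_cast
      linear_combination P.β * q * (P.ε * r + (P.γ + P.κ)) * hcγ - P.β * q * hσ + P.β * q * r * hτ
    have hκ2 : √P.κ * √P.κ = P.κ := Real.mul_self_sqrt h.κ_pos.le
    simp only [Matrix.cons_val]
    rw [w0, w1, w6, w7]
    simp only [Complex.normSq_mul, hp1, hq1, hc2, Complex.normSq_ofReal, hκ2, ← sq, hβ2]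
    ring
  · rw [modeRow_mul_A, rowPlus_mul_C, neg_add, cis_add, cis_add]
    push_cast
    -- Only the $a_1$ and $b_2^*$ columns see the other amplifier, so only these use the loop
    -- equations.
    congr 1
    · apply mul_left_cancel₀ hS
      linear_combination (-(P.γ + P.κ) / 2 * q * ((P.γ + P.κ) * r + P.ε) +
        P.ε / 2 * q * (P.ε * r + (P.γ + P.κ)) -
        P.α * P.γ * cis θ₁ * p * (P.ε * r' + (P.γ + P.κ))) * hcS +
        (√P.γ : ℝ) * (P.gap * hr + P.α * cis θ₁ * p * hσ - P.α * cis θ₁ * p * r' * hτ) -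
        (√P.γ : ℝ) * q * r * hSv
    · apply mul_left_cancel₀ hS
      linear_combination (P.ε / 2 * q * ((P.γ + P.κ) * r + P.ε) -
        (P.γ + P.κ) / 2 * q * (P.ε * r + (P.γ + P.κ))) * hcS - q * (√P.γ : ℝ) * hSv
    · apply mul_left_cancel₀ hS
      linear_combination (P.ε / 2 * p * ((P.γ + P.κ) * r' + P.ε) -
        (P.γ + P.κ) / 2 * p * (P.ε * r' + (P.γ + P.κ))) * hcS - p * (√P.γ : ℝ) * hSv
    · apply mul_left_cancel₀ hS
      linear_combination (-(P.γ + P.κ) / 2 * p * ((P.γ + P.κ) * r' + P.ε) +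
        P.ε / 2 * p * (P.ε * r' + (P.γ + P.κ)) -
        P.α * P.γ * cis (-θ₂) * q * (P.ε * r + (P.γ + P.κ))) * hcS +
        (√P.γ : ℝ) * (P.gap * hr' + P.α * cis (-θ₂) * q * hσ - P.α * cis (-θ₂) * q * r * hτ) -
        (√P.γ : ℝ) * p * r' * hSv

end Stable
-- Solution of the loop and closed form of the spectrum
theorem normSq_real_mul_add_real (a b : ℝ) (r : ℂ) :
    Complex.normSq (a * r + b) = a ^ 2 * Complex.normSq r + 2 * a * b * r.re + b ^ 2 := by
  simp [Complex.normSq_apply]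
  ring

/-- Squared modulus of the round-trip determinant. -/
noncomputable def loopDet (P : NOPAParams) (m : ℝ) : ℝ :=
  1 + P.loopGain ^ 4 - 2 * P.loopGain ^ 2 * Real.cos (2 * m)

theorem normSq_one_sub_sq_mul (g m : ℝ) :
    Complex.normSq (1 - g ^ 2 * cis m ^ 2) = 1 + g ^ 4 - 2 * g ^ 2 * Real.cos (2 * m) := by
  have h1 := Real.cos_sq_add_sin_sq m
  rw [Real.cos_two_mul]
  simp [Complex.normSq_apply, sq]
  linear_combination (g ^ 4 * (Real.cos m ^ 2 + Real.sin m ^ 2 + 1) + 2 * g ^ 2) * h1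

/-- Amplitude of the field circulating in the loop. -/
noncomputable def loopAmp (P : NOPAParams) (m x : ℝ) : ℂ :=
  P.α * P.dirGain * cis m * (cis x - P.loopGain * cis m) / (1 - P.loopGain ^ 2 * cis m ^ 2)

theorem normSq_loopAmp (P : NOPAParams) (m x : ℝ) :
    Complex.normSq (P.loopAmp m x) = P.α ^ 2 * P.dirGain ^ 2 *
      (1 + P.loopGain ^ 2 - 2 * P.loopGain * Real.cos (x - m)) / P.loopDet m := by
  have : Complex.normSq (cis x - P.loopGain * cis m) =
      1 + P.loopGain ^ 2 - 2 * P.loopGain * Real.cos (x - m) := by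
    rw [Real.cos_sub]
    simp [Complex.normSq_apply]
    linear_combination Real.cos_sq_add_sin_sq x + P.loopGain ^ 2 * Real.cos_sq_add_sin_sq m
  rw [loopAmp, Complex.normSq_div, normSq_one_sub_sq_mul, Complex.normSq_mul, this,
    Complex.normSq_mul, Complex.normSq_mul, normSq_cis, Complex.normSq_ofReal,
    Complex.normSq_ofReal, loopDet]
  ring

theorem loopAmp_re (P : NOPAParams) (m x : ℝ) :
    (P.loopAmp m x).re = P.α * P.dirGain * (Real.cos (x + m) - P.loopGain ^ 2 * Real.cos (x - m)
      - P.loopGain * Real.cos (2 * m) + P.loopGain ^ 3) / P.loopDet m := by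
  have h1 := Real.cos_sq_add_sin_sq m
  rw [loopAmp, Complex.div_re, normSq_one_sub_sq_mul, ← loopDet, ← add_div]
  congr 1
  rw [Real.cos_add, Real.cos_sub, Real.cos_two_mul]
  simp [sq]
  linear_combination P.α * P.dirGain * (P.loopGain
    - P.loopGain ^ 2 * (Real.cos x * Real.cos m + Real.sin x * Real.sin m)
    + P.loopGain ^ 3 * (Real.cos m ^ 2 + Real.sin m ^ 2 + 1)) * h1

/-- Noise power of the loss channels of a single amplifier. -/
noncomputable def lossNoise (P : NOPAParams) : ℝ :=
  4 * P.κ * P.γ / P.gap ^ 2 * ((P.γ + P.κ) ^ 2 + P.ε ^ 2)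

/-- Coefficient in the spectrum of the power of the field circulating in the loop. -/
noncomputable def loopPower (P : NOPAParams) : ℝ :=
  (P.dirGain ^ 2 + P.lossNoise + (1 - P.α ^ 2) * P.crossGain ^ 2) * (P.α ^ 2 * P.dirGain ^ 2)

/-- Coefficient in the spectrum of the interference of the circulating field with the inputs. -/
noncomputable def loopCross (P : NOPAParams) : ℝ :=
  (16 * P.κ * P.γ / P.gap ^ 2 * ((P.γ + P.κ) * P.ε)
    - 2 * (2 - P.α ^ 2) * P.dirGain * P.crossGain) * (P.α * P.dirGain)

/-- Part of the spectrum independent of the circulating field. -/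
noncomputable def baseNoise (P : NOPAParams) : ℝ :=
  P.crossGain ^ 2 + P.lossNoise + (1 - P.α ^ 2) * P.dirGain ^ 2

namespace Stable

theorem β_sq {P : NOPAParams} (h : P.Stable) : P.β ^ 2 = 1 - P.α ^ 2 :=
  Real.sq_sqrt (by nlinarith [h.α_pos, h.α_le_one])

/-- Its smallest possible value, at $\cos 2m=1$, is $(1-g^2)^2$. -/
theorem loopDet_pos {P : NOPAParams} (h : P.Stable) (m : ℝ) : 0 < P.loopDet m := by
  have h1 := h.loopGain_pos
  have h2 : P.loopGain ^ 2 < 1 := by nlinarith [h.loopGain_lt_one]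
  unfold loopDet
  nlinarith [Real.cos_le_one (2 * m), sq_pos_of_pos (sub_pos.2 h2), pow_pos h1 2]

theorem one_sub_ne_zero {P : NOPAParams} (h : P.Stable) (m : ℝ) :
    (1 - P.loopGain ^ 2 * cis m ^ 2 : ℂ) ≠ 0 := by
  rw [← Complex.normSq_pos, normSq_one_sub_sq_mul]
  exact h.loopDet_pos m

/-- The loop equations for $r$ and $r'$ are exchanged by $x\mapsto-x$, so this one identity covers
both. -/
theorem loopAmp_eq {P : NOPAParams} (h : P.Stable) (m x : ℝ) : P.loopAmp m x =
    P.α * cis m * cis x * (P.dirGain - P.crossGain * P.loopAmp m (-x)) := by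
  have h0 := h.one_sub_ne_zero m
  have hx := cis_mul_cis_neg x
  have hg : (P.loopGain : ℂ) = P.α * P.crossGain := by simp [loopGain]
  unfold loopAmp
  rw [div_eq_iff h0, mul_assoc _ _ (1 - _), sub_mul, mul_div_assoc', div_mul_cancel₀ _ h0]
  linear_combination P.α ^ 2 * P.crossGain * P.dirGain * cis m ^ 2 * hx +
    (P.α * P.dirGain * cis m ^ 3 * cis x * P.loopGain - P.α * P.dirGain * cis m ^ 2) * hg

/-- Here $C$ stands for $\cos m\cos(n+\phi)$ and $w$ for $\cos 2m$; keeping them free makes this a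
rational identity in the parameters. -/
theorem numerator_eq {P : NOPAParams} (h : P.Stable) (C w : ℝ) :
    P.c₁ + 2 * P.c₂ * C + P.c₃ * w =
      P.gap ^ 4 * (
        P.loopPower * (1 + P.loopGain ^ 2 - 2 * P.loopGain * C)
        + P.loopCross * ((1 - P.loopGain ^ 2) * C - P.loopGain * w + P.loopGain ^ 3)
        + P.baseNoise * (1 + P.loopGain ^ 4 - 2 * P.loopGain ^ 2 * w)) := by
  have hS := h.gap_pos
  rw [c₁, c₂, c₃, h.β_sq, loopPower, loopCross, baseNoise, lossNoise, loopGain, dirGain, crossGain]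
  field_simp
  rw [gap]
  ring

theorem denominator_eq {P : NOPAParams} (h : P.Stable) (w : ℝ) :
    P.c₄ - P.c₅ * w = P.gap ^ 4 * (1 + P.loopGain ^ 4 - 2 * P.loopGain ^ 2 * w) := by
  have := h.gap_pos.ne'
  rw [loopGain, crossGain, c₄, c₅]
  field_simp
  rw [gap]
  ring

/-- The loop equations see the phases only through $m$ and $x=n+\phi_1+\phi_2$. Adding the
contributions of $r$ and $r'$ symmetrizes in $x$, and $\cos(x-m)+\cos(x+m)=2\cos m\cos x$. -/
theorem Vplus_eq {P : NOPAParams} (h : P.Stable) (m n φ₁ φ₂ : ℝ) :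
    P.Vplus (n + m) (n - m) φ₁ φ₂ =
      2 * ((P.c₁ + 2 * P.c₂ * (Real.cos m * Real.cos (n + (φ₁ + φ₂)))
        + P.c₃ * Real.cos (2 * m)) / (P.c₄ - P.c₅ * Real.cos (2 * m))) := by
  have e1 : cis (n + m) * cis φ₂ = cis (-φ₁) * (cis m * cis (n + (φ₁ + φ₂))) := by
    simp only [← cis_add]
    congr 1
    ring
  have e2 : cis (-(n - m)) * cis (-φ₁) = cis φ₂ * (cis m * cis (-(n + (φ₁ + φ₂)))) := by
    simp only [← cis_add]
    congr 1
    ring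
  have hr := h.loopAmp_eq m (n + (φ₁ + φ₂))
  have hr' := h.loopAmp_eq m (-(n + (φ₁ + φ₂)))
  rw [neg_neg] at hr'
  rw [h.Vplus_eq_of_loop _ _ _ _ (P.loopAmp m (n + (φ₁ + φ₂))) (P.loopAmp m (-(n + (φ₁ + φ₂))))
    (by linear_combination cis (-φ₁) * hr -
      P.α * (P.dirGain - P.crossGain * P.loopAmp m (-(n + (φ₁ + φ₂)))) * e1)
    (by linear_combination cis φ₂ * hr' -
      P.α * (P.dirGain - P.crossGain * P.loopAmp m (n + (φ₁ + φ₂))) * e2)]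
  generalize n + (φ₁ + φ₂) = x
  have f1 : ∀ r : ℂ, Complex.normSq (P.dirGain * r - P.crossGain) =
      P.dirGain ^ 2 * Complex.normSq r - 2 * P.dirGain * P.crossGain * r.re + P.crossGain ^ 2 := by
    intro r
    have := normSq_real_mul_add_real P.dirGain (-P.crossGain) r
    push_cast at this
    rw [← sub_eq_add_neg] at this
    rw [this]
    ring
  have f2 : ∀ r : ℂ, Complex.normSq (P.dirGain - P.crossGain * r) =
      P.crossGain ^ 2 * Complex.normSq r - 2 * P.dirGain * P.crossGain * r.re + P.dirGain ^ 2 := by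
    intro r
    have := normSq_real_mul_add_real (-P.crossGain) P.dirGain r
    rw [show (P.dirGain - P.crossGain * r : ℂ) = (-P.crossGain : ℝ) * r + P.dirGain by
      push_cast; ring, this]
    ring
  have f3 : ∀ r : ℂ, Complex.normSq ((P.γ + P.κ) * r + P.ε) =
      (P.γ + P.κ) ^ 2 * Complex.normSq r + 2 * (P.γ + P.κ) * P.ε * r.re + P.ε ^ 2 := by
    intro r
    exact_mod_cast normSq_real_mul_add_real (P.γ + P.κ) P.ε r
  have f4 : ∀ r : ℂ, Complex.normSq (P.ε * r + (P.γ + P.κ)) =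
      P.ε ^ 2 * Complex.normSq r + 2 * P.ε * (P.γ + P.κ) * r.re + (P.γ + P.κ) ^ 2 := by
    intro r
    exact_mod_cast normSq_real_mul_add_real P.ε (P.γ + P.κ) r
  have hD := h.loopDet_pos m
  have hS := h.gap_pos
  rw [f1, f1, f2, f2, f3, f3, f4, f4, normSq_loopAmp, normSq_loopAmp, loopAmp_re, loopAmp_re,
    h.denominator_eq, h.numerator_eq, ← loopDet, loopPower, loopCross, baseNoise,
    lossNoise]
  rw [Real.cos_sub, Real.cos_sub, Real.cos_add, Real.cos_add, Real.cos_neg, Real.sin_neg]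
  generalize P.loopDet m = d at hD
  generalize P.gap = G at hS
  field_simp
  ring

end Stable
-- The spectrum as a function of $t=|\cos m|$
/-- The improved spectrum as a function of `t = |cos m|`. -/
noncomputable def profile (P : NOPAParams) (t : ℝ) : ℝ :=
  2 * ((P.c₁ + 2 * P.c₂ * t + P.c₃ * (2 * t ^ 2 - 1)) / (P.c₄ - P.c₅ * (2 * t ^ 2 - 1)))

theorem profile_zero (P : NOPAParams) :
    P.profile 0 = 2 * ((P.c₁ - P.c₃) / (P.c₄ + P.c₅)) := by
  unfold profile
  congr 2 <;> ring

theorem profile_one (P : NOPAParams) :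
    P.profile 1 = 2 * ((P.c₁ + 2 * P.c₂ + P.c₃) / (P.c₄ - P.c₅)) := by
  unfold profile
  congr 2 <;> ring

namespace Stable

theorem profile_eq {P : NOPAParams} (h : P.Stable) {t : ℝ} (ht : t ∈ Set.Icc (0 : ℝ) 1) :
    P.profile t = 2 * ((P.loopPower + P.loopCross * (t + P.loopGain)) /
      (1 + P.loopGain ^ 2 + 2 * P.loopGain * t) + P.baseNoise) := by
  have hg := h.loopGain_pos
  have hg1 := h.loopGain_lt_one
  have hS := h.gap_pos
  have h1 : 0 < 1 + P.loopGain ^ 2 + 2 * P.loopGain * t := by have := ht.1; positivity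
  have h2 : 0 < 1 + P.loopGain ^ 2 - 2 * P.loopGain * t := by
    nlinarith [ht.2, sq_pos_of_pos (sub_pos.2 hg1)]
  have h3 : 1 + P.loopGain ^ 4 - 2 * P.loopGain ^ 2 * (2 * t ^ 2 - 1) =
      (1 + P.loopGain ^ 2 - 2 * P.loopGain * t) * (1 + P.loopGain ^ 2 + 2 * P.loopGain * t) := by
    ring
  rw [profile, h.numerator_eq, h.denominator_eq, mul_div_mul_left _ _ (pow_pos hS 4).ne', h3]
  have h4 : (1 - P.loopGain ^ 2) * t - P.loopGain * (2 * t ^ 2 - 1) + P.loopGain ^ 3 =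
      (t + P.loopGain) * (1 + P.loopGain ^ 2 - 2 * P.loopGain * t) := by ring
  rw [h4]
  generalize 1 + P.loopGain ^ 2 - 2 * P.loopGain * t = a at *
  generalize 1 + P.loopGain ^ 2 + 2 * P.loopGain * t = b at *
  field_simp

theorem lossNoise_pos {P : NOPAParams} (h : P.Stable) : 0 < P.lossNoise := by
  have := h.gap_pos
  have := h.κ_pos
  have := h.γ_pos
  have := h.ε_pos
  unfold lossNoise
  positivity

theorem one_sub_sq_nonneg {P : NOPAParams} (h : P.Stable) : 0 ≤ 1 - P.α ^ 2 := by
  nlinarith [h.α_pos, h.α_le_one]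

theorem loopPower_nonneg {P : NOPAParams} (h : P.Stable) : 0 ≤ P.loopPower := by
  have := h.lossNoise_pos
  have := h.one_sub_sq_nonneg
  unfold loopPower
  positivity

theorem dirGain_neg {P : NOPAParams} (h : P.Stable) (hκ : P.κ ≤ P.ε) : P.dirGain < 0 := by
  have := h.κ_pos
  have := h.γ_pos
  exact div_neg_of_neg_of_pos (by nlinarith) h.gap_pos

theorem loopCross_neg {P : NOPAParams} (h : P.Stable) (hκ : P.κ ≤ P.ε) : P.loopCross < 0 := by
  have hσ := h.dirGain_neg hκ
  have hτ := h.crossGain_pos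
  have h1 := h.one_sub_sq_nonneg
  have h2 : 0 < 16 * P.κ * P.γ / P.gap ^ 2 * ((P.γ + P.κ) * P.ε) := by
    have := h.gap_pos
    have := h.κ_pos
    have := h.γ_pos
    have := h.ε_pos
    positivity
  have h3 : 0 < (2 - P.α ^ 2) * -P.dirGain * P.crossGain :=
    mul_pos (mul_pos (by linarith) (neg_pos.2 hσ)) hτ
  exact mul_neg_of_pos_of_neg (by linarith) (mul_neg_of_pos_of_neg h.α_pos hσ)

/-- The derivative of the Möbius part has the sign of `loopCross` $\cdot(1-g^2)-2g\,\cdot$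
`loopPower`, which is negative: `loopCross` is negative and `loopPower` nonnegative. -/
theorem strictAntiOn_profile {P : NOPAParams} (h : P.Stable) (hκ : P.κ ≤ P.ε) :
    StrictAntiOn P.profile (Set.Icc 0 1) := by
  intro s hs t ht hst
  rw [h.profile_eq hs, h.profile_eq ht]
  have hg := h.loopGain_pos
  have hg1 := h.loopGain_lt_one
  have hu := h.loopPower_nonneg
  have hv := h.loopCross_neg hκ
  have hs0 := hs.1
  have ht0 := ht.1
  gcongr 2 * (?_ + _)
  rw [div_lt_div_iff₀ (by positivity) (by positivity)]
  have h1 : P.loopCross * (1 - P.loopGain ^ 2) < 0 :=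
    mul_neg_of_neg_of_pos hv (by nlinarith)
  have h2 : 0 ≤ P.loopGain * P.loopPower := by positivity
  nlinarith [mul_pos (sub_pos.2 hst) (show 0 < 2 * (P.loopGain * P.loopPower) -
    P.loopCross * (1 - P.loopGain ^ 2) by linarith)]

theorem continuousOn_profile {P : NOPAParams} (h : P.Stable) :
    ContinuousOn P.profile (Set.Icc 0 1) := by
  have hg := h.loopGain_pos
  refine ContinuousOn.congr ?_ fun t ht => h.profile_eq ht
  refine ContinuousOn.mul continuousOn_const (ContinuousOn.add (ContinuousOn.div ?_ ?_ ?_)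
    continuousOn_const)
  · fun_prop
  · fun_prop
  · intro t ht
    have := ht.1
    positivity

theorem two_lt_profile_zero {P : NOPAParams} (h : P.Stable) (hκ : 2 * P.κ ≤ P.ε) :
    2 < P.profile 0 := by
  have hS := h.gap_pos
  have hκ0 := h.κ_pos
  have hγ0 := h.γ_pos
  have hε0 := h.ε_pos
  have hα0 := h.α_pos
  have hτ := h.crossGain_pos
  have h1 := h.one_sub_sq_nonneg
  -- The excess of half the spectrum over $1$ at $t=0$, cleared of the denominator $1+g^2$. Only the
  -- bracket in the middle term has a sign in doubt.
  have hid : P.loopPower + P.loopCross * P.loopGain + (P.baseNoise - 1) * (1 + P.loopGain ^ 2) =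
      2 * P.crossGain ^ 2 * (1 - P.α ^ 2)
      + 8 * P.ε ^ 2 * P.κ * P.γ / P.gap ^ 2 * (1 + P.α ^ 2 - P.α ^ 2 * (4 * P.κ * P.γ / P.gap))
      + 8 * P.κ ^ 2 * P.α ^ 2 * P.crossGain ^ 2 / P.gap := by
    rw [loopPower, loopCross, baseNoise, lossNoise, loopGain, dirGain, crossGain]
    field_simp
    rw [gap]
    ring
  -- From $\mathrm{gap}>2\alpha\epsilon\gamma\ge4\alpha\kappa\gamma$; this is where
  -- $2\kappa\le\epsilon$ enters.
  have hδ : P.α * (4 * P.κ * P.γ / P.gap) < 1 := by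
    rw [← mul_div_assoc, div_lt_one hS]
    nlinarith [h.gap_gt, mul_pos hα0 hγ0]
  have hpos : 0 < P.loopPower + P.loopCross * P.loopGain +
      (P.baseNoise - 1) * (1 + P.loopGain ^ 2) := by
    have h2 : 0 < 1 + P.α ^ 2 - P.α ^ 2 * (4 * P.κ * P.γ / P.gap) := by
      nlinarith [h.α_le_one, mul_lt_mul_of_pos_left hδ hα0]
    rw [hid]
    positivity
  rw [h.profile_eq (by simp)]
  have hN : 0 < 1 + P.loopGain ^ 2 := by positivity
  have : 1 < (P.loopPower + P.loopCross * (0 + P.loopGain)) /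
      (1 + P.loopGain ^ 2 + 2 * P.loopGain * 0) + P.baseNoise := by
    rw [zero_add, mul_zero, add_zero, ← sub_lt_iff_lt_add, lt_div_iff₀ hN]
    linarith
  linarith

/-- In the last factor of $c_2$ the positive terms are absorbed: $\epsilon^4\le\gamma^4$ and
$4\alpha^2\kappa\epsilon^2\gamma\le4\kappa\gamma^3$. -/
theorem c₂_neg {P : NOPAParams} (h : P.Stable) (hκ : P.κ ≤ P.ε) (hε : P.ε ≤ P.γ) :
    P.c₂ < 0 := by
  have hκ0 := h.κ_pos
  have hγ0 := h.γ_pos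
  have hε0 := h.ε_pos
  have hα0 := h.α_pos
  have h1 : 0 < -P.κ ^ 2 + P.ε ^ 2 + P.γ ^ 2 := by nlinarith
  have h2 : P.ε ^ 4 ≤ P.γ ^ 4 := by gcongr
  have h3 : P.α ^ 2 * P.ε ^ 2 ≤ 1 * P.γ ^ 2 := by
    gcongr
    linarith [h.one_sub_sq_nonneg]
  have h4 : P.κ * P.γ * (P.α ^ 2 * P.ε ^ 2) ≤ P.κ * P.γ * (1 * P.γ ^ 2) := by gcongr
  have h5 : 0 < P.κ ^ 4 + 4 * P.κ ^ 3 * P.γ + 6 * P.κ ^ 2 * P.γ ^ 2 := by positivity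
  refine mul_neg_of_pos_of_neg (mul_pos (by positivity) h1) ?_
  linarith

end Stable
-- Back to the angle $m$: monotonicity, extrema, threshold
theorem Vim_eq_profile (P : NOPAParams) {m : ℝ} (hm : m ∈ Set.Ioc (-Real.pi) Real.pi) :
    P.Vim m = P.profile |Real.cos m| := by
  have hpi := Real.pi_pos
  unfold Vim profile
  rw [sq_abs, ← Real.cos_two_mul]
  split_ifs with h1 h2
  · rw [abs_of_pos (Real.cos_pos_of_mem_Ioo h1)]
  · have hc : Real.cos m = 0 := by rcases h2 with rfl | rfl <;> simp
    rw [Real.cos_two_mul, hc]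
    congr 2 <;> simp <;> ring
  · have hc : Real.cos m ≤ 0 := by
      by_cases h : m ≤ 0
      · have h' : m ≤ -(Real.pi / 2) := by
          by_contra h3
          exact h1 ⟨not_le.1 h3, by linarith⟩
        rw [← Real.cos_neg]
        exact Real.cos_nonpos_of_pi_div_two_le_of_le (by linarith) (by linarith [hm.1])
      · have h' : Real.pi / 2 ≤ m := by
          by_contra h3
          exact h1 ⟨by linarith, not_le.1 h3⟩
        exact Real.cos_nonpos_of_pi_div_two_le_of_le h' (by linarith [hm.2])
    rw [abs_of_nonpos hc]
    congr 2
    ring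

theorem abs_cos_mem_Icc (m : ℝ) : |Real.cos m| ∈ Set.Icc (0 : ℝ) 1 :=
  ⟨abs_nonneg _, Real.abs_cos_le_one m⟩

/-- The optimal phase makes $\cos(n+\phi)$ the sign of $\cos m$; at $m=\pm\pi/2$ both sides vanish
whatever $\phi$ is. -/
theorem IsOptimalPhase.cos_mul_cos {m n φ : ℝ} (hm : m ∈ Set.Ioc (-Real.pi) Real.pi)
    (h : IsOptimalPhase m n φ) : Real.cos m * Real.cos (n + φ) = |Real.cos m| := by
  have hpi := Real.pi_pos
  by_cases h1 : m ∈ Set.Ioo (-(Real.pi / 2)) (Real.pi / 2)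
  · rw [h.1 h1, add_neg_cancel, Real.cos_zero, mul_one, abs_of_pos (Real.cos_pos_of_mem_Ioo h1)]
  by_cases h2 : m ∈ Set.Ioo (-Real.pi) (-(Real.pi / 2)) ∪ Set.Ioc (Real.pi / 2) Real.pi
  · have hc : Real.cos (n + φ) = -1 := by
      rcases h.2 h2 with h3 | h3
      · rw [h3, add_sub_cancel, Real.cos_pi]
      · rw [h3, add_sub_cancel, Real.cos_neg, Real.cos_pi]
    have hc' : Real.cos m ≤ 0 := by
      rcases h2 with h2 | h2
      · rw [← Real.cos_neg]
        exact Real.cos_nonpos_of_pi_div_two_le_of_le (by linarith [h2.2]) (by linarith [h2.1])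
      · exact Real.cos_nonpos_of_pi_div_two_le_of_le h2.1.le (by linarith [h2.2])
    rw [hc, abs_of_nonpos hc', mul_neg_one]
  · have hc : Real.cos m = 0 := by
      have : m = Real.pi / 2 ∨ m = -(Real.pi / 2) := by
        rcases lt_trichotomy m (-(Real.pi / 2)) with h3 | h3 | h3
        · exact absurd (Or.inl ⟨hm.1, h3⟩) h2
        · exact Or.inr h3
        · rcases lt_trichotomy m (Real.pi / 2) with h4 | h4 | h4
          · exact absurd ⟨h3, h4⟩ h1
          · exact Or.inl h4
          · exact absurd (Or.inr ⟨h4, hm.2⟩) h2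
      rcases this with rfl | rfl <;> simp
    rw [hc, zero_mul, abs_zero]

theorem abs_cos_eq_one_iff {m : ℝ} (hm : m ∈ Set.Ioc (-Real.pi) Real.pi) :
    |Real.cos m| = 1 ↔ m = 0 ∨ m = Real.pi := by
  constructor
  · intro h
    rcases eq_or_lt_of_le hm.2 with h1 | h1
    · exact Or.inr h1
    · left
      have h2 : Real.sin m = 0 := by
        rw [← sq_eq_zero_iff, Real.sin_sq, ← sq_abs, h]
        norm_num
      exact (Real.sin_eq_zero_iff_of_lt_of_lt hm.1 h1).1 h2
  · rintro (rfl | rfl) <;> simp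

theorem cos_eq_zero_iff_of_mem_Ioc {m : ℝ} (hm : m ∈ Set.Ioc (-Real.pi) Real.pi) :
    Real.cos m = 0 ↔ m = Real.pi / 2 ∨ m = -(Real.pi / 2) := by
  constructor
  · intro h
    have h1 : Real.cos |m| = Real.cos (Real.pi / 2) := by rw [Real.cos_abs, h, Real.cos_pi_div_two]
    have h2 := Real.injOn_cos ⟨abs_nonneg m, abs_le.2 ⟨hm.1.le, hm.2⟩⟩
      ⟨by linarith [Real.pi_pos], by linarith [Real.pi_pos]⟩ h1
    exact (abs_eq (by linarith [Real.pi_pos])).1 h2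
  · rintro (rfl | rfl) <;> simp

theorem strictAntiOn_abs_cos : StrictAntiOn (fun m => |Real.cos m|) (Set.Icc 0 (Real.pi / 2)) := by
  intro a ha b hb hab
  have hpi := Real.pi_pos
  have := Real.strictAntiOn_cos ⟨ha.1, by linarith [ha.2]⟩ ⟨hb.1, by linarith [hb.2]⟩ hab
  have hb0 := Real.cos_nonneg_of_mem_Icc ⟨by linarith [hb.1], hb.2⟩
  change |Real.cos b| < |Real.cos a|
  rwa [abs_of_nonneg hb0, abs_of_nonneg (hb0.trans this.le)]

theorem strictMonoOn_abs_cos :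
    StrictMonoOn (fun m => |Real.cos m|) (Set.Icc (Real.pi / 2) Real.pi) := by
  intro a ha b hb hab
  have h := strictAntiOn_abs_cos (a := Real.pi - b) (b := Real.pi - a)
    ⟨by linarith [hb.2], by linarith [hb.1]⟩ ⟨by linarith [ha.2], by linarith [ha.1]⟩
    (by linarith)
  simpa [Real.cos_pi_sub] using h

namespace Stable

theorem Vminus_eq {P : NOPAParams} (h : P.Stable) (m n φ₁ φ₂ : ℝ) :
    P.Vminus (n + m) (n - m) φ₁ φ₂ = P.Vplus (n + m) (n - m) φ₁ φ₂ := by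
  rw [Vminus_eq_Vplus, h.Vplus_eq, h.Vplus_eq]
  congr 8
  ring

theorem Vplus_eq_Vim {P : NOPAParams} (h : P.Stable) {m : ℝ}
    (hm : m ∈ Set.Ioc (-Real.pi) Real.pi) {n φ₁ φ₂ : ℝ}
    (hφ : IsOptimalPhase m n (φ₁ + φ₂)) : P.Vplus (n + m) (n - m) φ₁ φ₂ = P.Vim m := by
  rw [h.Vplus_eq, hφ.cos_mul_cos hm, P.Vim_eq_profile hm, profile, sq_abs, Real.cos_two_mul]

theorem Vim_le_Vplus {P : NOPAParams} (h : P.Stable) (hκ : P.κ ≤ P.ε) (hε : P.ε ≤ P.γ) {m : ℝ}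
    (hm : m ∈ Set.Ioc (-Real.pi) Real.pi) (n φ₁ φ₂ : ℝ) :
    P.Vim m ≤ P.Vplus (n + m) (n - m) φ₁ φ₂ := by
  rw [h.Vplus_eq, P.Vim_eq_profile hm, profile, sq_abs, Real.cos_two_mul]
  have hc := h.c₂_neg hκ hε
  have hC : Real.cos m * Real.cos (n + (φ₁ + φ₂)) ≤ |Real.cos m| := by
    refine (le_abs_self _).trans ?_
    rw [abs_mul]
    exact mul_le_of_le_one_right (abs_nonneg _) (Real.abs_cos_le_one _)
  have hD : 0 < P.c₄ - P.c₅ * (2 * Real.cos m ^ 2 - 1) := by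
    rw [h.denominator_eq, ← Real.cos_two_mul]
    exact mul_pos (pow_pos h.gap_pos 4) (h.loopDet_pos m)
  gcongr ?_ * (?_ / _)
  nlinarith

theorem Vnops_eq {P : NOPAParams} (h : P.Stable) : P.Vnops = P.profile 1 := by
  have := h.Vplus_eq 0 0 0 0
  simp only [add_zero, sub_zero, mul_zero, Real.cos_zero, mul_one] at this
  rw [Vnops, this, profile_one]

theorem Vminus_zero {P : NOPAParams} (h : P.Stable) : P.Vminus 0 0 0 0 = P.Vnops := by
  simpa [Vnops] using h.Vminus_eq 0 0 0 0

theorem strictMonoOn_Vim_right {P : NOPAParams} (h : P.Stable) (hκ : P.κ ≤ P.ε) :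
    StrictMonoOn P.Vim (Set.Icc 0 (Real.pi / 2)) := by
  have hpi := Real.pi_pos
  intro a ha b hb hab
  rw [P.Vim_eq_profile (m := a) ⟨by linarith [ha.1], by linarith [ha.2]⟩,
    P.Vim_eq_profile (m := b) ⟨by linarith [hb.1], by linarith [hb.2]⟩]
  exact h.strictAntiOn_profile hκ (abs_cos_mem_Icc b) (abs_cos_mem_Icc a)
    (strictAntiOn_abs_cos ha hb hab)

theorem strictAntiOn_Vim_right {P : NOPAParams} (h : P.Stable) (hκ : P.κ ≤ P.ε) :
    StrictAntiOn P.Vim (Set.Icc (Real.pi / 2) Real.pi) := by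
  have hpi := Real.pi_pos
  intro a ha b hb hab
  rw [P.Vim_eq_profile (m := a) ⟨by linarith [ha.1], by linarith [ha.2]⟩,
    P.Vim_eq_profile (m := b) ⟨by linarith [hb.1], by linarith [hb.2]⟩]
  exact h.strictAntiOn_profile hκ (abs_cos_mem_Icc a) (abs_cos_mem_Icc b)
    (strictMonoOn_abs_cos ha hb hab)

end Stable

theorem Vim_neg (P : NOPAParams) {m : ℝ} (hm : m ∈ Set.Ioo (-Real.pi) Real.pi) :
    P.Vim (-m) = P.Vim m := by
  rw [P.Vim_eq_profile ⟨by linarith [hm.2], by linarith [hm.1]⟩, P.Vim_eq_profile ⟨hm.1, hm.2.le⟩,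
    Real.cos_neg]

namespace Stable

theorem strictAntiOn_Vim_left {P : NOPAParams} (h : P.Stable) (hκ : P.κ ≤ P.ε) :
    StrictAntiOn P.Vim (Set.Icc (-(Real.pi / 2)) 0) := by
  have hpi := Real.pi_pos
  intro a ha b hb hab
  rw [← P.Vim_neg (m := a) ⟨by linarith [ha.1], by linarith [ha.2]⟩,
    ← P.Vim_neg (m := b) ⟨by linarith [hb.1], by linarith [hb.2]⟩]
  exact h.strictMonoOn_Vim_right hκ ⟨by linarith [hb.2], by linarith [hb.1]⟩
    ⟨by linarith [ha.2], by linarith [ha.1]⟩ (by linarith)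

theorem strictMonoOn_Vim_left {P : NOPAParams} (h : P.Stable) (hκ : P.κ ≤ P.ε) :
    StrictMonoOn P.Vim (Set.Ioc (-Real.pi) (-(Real.pi / 2))) := by
  have hpi := Real.pi_pos
  intro a ha b hb hab
  rw [← P.Vim_neg (m := a) ⟨by linarith [ha.1], by linarith [ha.2]⟩,
    ← P.Vim_neg (m := b) ⟨by linarith [hb.1], by linarith [hb.2]⟩]
  exact h.strictAntiOn_Vim_right hκ ⟨by linarith [hb.2], by linarith [hb.1]⟩
    ⟨by linarith [ha.2], by linarith [ha.1]⟩ (by linarith)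

theorem EPREntangled_iff {P : NOPAParams} (h : P.Stable) {m : ℝ}
    (hm : m ∈ Set.Ioc (-Real.pi) Real.pi) {n φ₁ φ₂ : ℝ}
    (hφ : IsOptimalPhase m n (φ₁ + φ₂)) :
    P.EPREntangled (n + m) (n - m) φ₁ φ₂ ↔ P.Vim m < 2 := by
  rw [EPREntangled, h.Vminus_eq, h.Vplus_eq_Vim hm hφ]
  constructor <;> intro <;> linarith

/-- Local rotations are absorbed into $\phi_1,\phi_2$, and no choice of these brings either spectrum
below `Vim`. Conversely, take both rotations trivial. -/
theorem EPREntangledUpToRotation_iff {P : NOPAParams} (h : P.Stable) (hκ : P.κ ≤ P.ε)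
    (hε : P.ε ≤ P.γ) {m : ℝ} (hm : m ∈ Set.Ioc (-Real.pi) Real.pi) {n φ₁ φ₂ : ℝ}
    (hφ : IsOptimalPhase m n (φ₁ + φ₂)) :
    P.EPREntangledUpToRotation (n + m) (n - m) φ₁ φ₂ ↔ P.Vim m < 2 := by
  have hrot : P.EPREntangledUpToRotation (n + m) (n - m) φ₁ φ₂ ↔
      ∃ ψ₁ ∈ Set.Ioc (-Real.pi) Real.pi, ∃ ψ₂ ∈ Set.Ioc (-Real.pi) Real.pi,
        P.EPREntangled (n + m) (n - m) (φ₁ + ψ₁) (φ₂ + ψ₂) := by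
    simp only [EPREntangledUpToRotation, EPREntangled, Vplus, Vminus, ← phaseRot_mul_H, phaseRot]
  rw [hrot]
  constructor
  · rintro ⟨ψ₁, -, ψ₂, -, hE⟩
    rw [EPREntangled, h.Vminus_eq] at hE
    linarith [h.Vim_le_Vplus hκ hε hm n (φ₁ + ψ₁) (φ₂ + ψ₂)]
  · intro hV
    have h0 : (0 : ℝ) ∈ Set.Ioc (-Real.pi) Real.pi := ⟨by linarith [Real.pi_pos], Real.pi_pos.le⟩
    refine ⟨0, h0, 0, h0, ?_⟩
    rw [add_zero, add_zero]
    exact (h.EPREntangled_iff hm hφ).2 hV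

/-- The angles at which the improved spectrum crosses the entanglement threshold. -/
theorem exists_threshold {P : NOPAParams} (h : P.Stable) (hκ : 2 * P.κ ≤ P.ε)
    (hV : P.Vnops < 2) : ∃ m₁ m₂ : ℝ, 0 < m₁ ∧ m₁ < Real.pi / 2 ∧ Real.pi / 2 < m₂ ∧ m₂ < Real.pi ∧
      {m ∈ Set.Ioc (-Real.pi) Real.pi | P.Vim m = 2} = {m₁, -m₁, m₂, -m₂} ∧
      ∀ m ∈ Set.Ioc (-Real.pi) Real.pi, P.Vim m < 2 ↔
        m ∈ Set.Ioo (-Real.pi) (-m₂) ∪ Set.Ioo (-m₁) m₁ ∪ Set.Ioc m₂ Real.pi := by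
  have hpi := Real.pi_pos
  have hκ' : P.κ ≤ P.ε := by linarith [h.κ_pos]
  have hanti := h.strictAntiOn_profile hκ'
  rw [h.Vnops_eq] at hV
  obtain ⟨t, ht, ht2⟩ := intermediate_value_Ioo' zero_le_one h.continuousOn_profile
    ⟨hV, h.two_lt_profile_zero hκ⟩
  have htI : t ∈ Set.Icc (0 : ℝ) 1 := ⟨ht.1.le, ht.2.le⟩
  -- With $t$ the unique crossing of the profile, the roots are the $m$ with $\cos m=\pm t$:
  -- $m_1=a$, $m_2=\pi-a$ and their negatives.
  set a := Real.arccos t with ha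
  have ha0 : 0 < a := Real.arccos_pos.2 ht.2
  have ha1 : a < Real.pi / 2 := Real.arccos_lt_pi_div_two.2 ht.1
  have hcos : Real.cos a = t := Real.cos_arccos (by linarith [ht.1]) ht.2.le
  have hcos' : Real.cos (Real.pi - a) = -t := by rw [Real.cos_pi_sub, hcos]
  have hcmp : ∀ m ∈ Set.Ioc (-Real.pi) Real.pi, ∀ b ∈ Set.Icc 0 Real.pi,
      (Real.cos b < Real.cos m ↔ |m| < b) ∧ (Real.cos m < Real.cos b ↔ b < |m|) := by
    intro m hm b hb
    have hmI : |m| ∈ Set.Icc 0 Real.pi := ⟨abs_nonneg m, abs_le.2 ⟨hm.1.le, hm.2⟩⟩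
    rw [← Real.cos_abs m]
    exact ⟨Real.strictAntiOn_cos.lt_iff_gt hb hmI, Real.strictAntiOn_cos.lt_iff_gt hmI hb⟩
  have haI : a ∈ Set.Icc 0 Real.pi := ⟨ha0.le, by linarith⟩
  have haI' : Real.pi - a ∈ Set.Icc 0 Real.pi := ⟨by linarith, by linarith⟩
  have hlt : ∀ m ∈ Set.Ioc (-Real.pi) Real.pi,
      (P.Vim m < 2 ↔ |m| < a ∨ Real.pi - a < |m|) := by
    intro m hm
    rw [P.Vim_eq_profile hm, ← ht2, hanti.lt_iff_gt (abs_cos_mem_Icc m) htI, lt_abs,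
      ← (hcmp m hm a haI).1, ← (hcmp m hm _ haI').2, hcos, hcos', lt_neg]
  have heq : ∀ m ∈ Set.Ioc (-Real.pi) Real.pi,
      (P.Vim m = 2 ↔ |m| = a ∨ |m| = Real.pi - a) := by
    intro m hm
    have hmI : |m| ∈ Set.Icc 0 Real.pi := ⟨abs_nonneg m, abs_le.2 ⟨hm.1.le, hm.2⟩⟩
    rw [P.Vim_eq_profile hm, ← ht2, hanti.injOn.eq_iff (abs_cos_mem_Icc m) htI,
      abs_eq ht.1.le, ← Real.injOn_cos.eq_iff hmI haI, ← Real.injOn_cos.eq_iff hmI haI', hcos,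
      hcos', Real.cos_abs]
  refine ⟨a, Real.pi - a, ha0, ha1, by linarith, by linarith, ?_, ?_⟩
  · ext m
    simp only [Set.mem_ofPred_eq, Set.mem_insert_iff, Set.mem_singleton_iff]
    constructor
    · rintro ⟨hm, hm2⟩
      rcases (heq m hm).1 hm2 with h1 | h1
      · rcases (abs_eq ha0.le).1 h1 with h2 | h2 <;> simp [h2]
      · rcases (abs_eq haI'.1).1 h1 with h2 | h2 <;> rw [h2] <;> simp
    · intro hm
      have hmI : m ∈ Set.Ioc (-Real.pi) Real.pi := by
        rcases hm with rfl | rfl | rfl | rfl <;> constructor <;> linarith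
      refine ⟨hmI, (heq m hmI).2 ?_⟩
      rcases hm with h1 | h1 | h1 | h1
      · exact Or.inl ((abs_eq ha0.le).2 (Or.inl h1))
      · exact Or.inl ((abs_eq ha0.le).2 (Or.inr h1))
      · exact Or.inr ((abs_eq haI'.1).2 (Or.inl h1))
      · exact Or.inr ((abs_eq haI'.1).2 (Or.inr h1))
  · intro m hm
    rw [hlt m hm, abs_lt, lt_abs]
    constructor
    · rintro (h1 | h1 | h1)
      · exact Or.inl (Or.inr h1)
      · exact Or.inr ⟨h1, hm.2⟩
      · exact Or.inl (Or.inl ⟨hm.1, by linarith⟩)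
    · rintro ((h1 | h1) | h1)
      · exact Or.inr (Or.inr (by linarith [h1.2]))
      · exact Or.inl h1
      · exact Or.inr (Or.inl h1.1)

end Stable

/-! ### Numerical constants and conclusion -/

theorem κr_le : 20 * κr ≤ γr := by
  have h2 : (1.4 : ℝ) ≤ √2 := Real.le_sqrt_of_sq_le (by norm_num)
  rw [κr, γr, ← mul_div_assoc, div_le_iff₀ (by positivity)]
  nlinarith

theorem γr_pos : 0 < γr := by
  unfold γr
  norm_num

end NOPAParams

theorem mainTheorem4 (P : NOPAParams) (x y : ℝ)
    (hx : x ∈ Set.Ioc (0 : ℝ) 1) (hy : y ∈ Set.Ioc (0 : ℝ) 1)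
    (hε : P.ε = x * NOPAParams.γr) (hγ : P.γ = NOPAParams.γr / y)
    (hκ : P.κ ∈ Set.Ioc 0 (NOPAParams.κr * x)) (hα : P.α ∈ Set.Ioc (0 : ℝ) 1)
    -- the network (without phase shifts) is stable
    (hstab : NOPAParams.IsHurwitz (P.A 0 0)) :
    -- `Vim m` is the value of both spectra when `φ = φ₀`, and `φ₀` is optimal
    (∀ m ∈ Set.Ioc (-Real.pi) Real.pi, ∀ n φ₁ φ₂ : ℝ,
      (NOPAParams.IsOptimalPhase m n (φ₁ + φ₂) →
        P.Vplus (n + m) (n - m) φ₁ φ₂ = P.Vim m ∧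
        P.Vminus (n + m) (n - m) φ₁ φ₂ = P.Vim m) ∧
      P.Vim m ≤ P.Vplus (n + m) (n - m) φ₁ φ₂ ∧
      P.Vim m ≤ P.Vminus (n + m) (n - m) φ₁ φ₂) ∧
    -- piecewise monotonicity
    StrictMonoOn P.Vim (Set.Ioc (-Real.pi) (-(Real.pi / 2))) ∧
    StrictAntiOn P.Vim (Set.Icc (-(Real.pi / 2)) 0) ∧
    StrictMonoOn P.Vim (Set.Icc 0 (Real.pi / 2)) ∧
    StrictAntiOn P.Vim (Set.Icc (Real.pi / 2) Real.pi) ∧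
    -- the minimum is the spectrum without phase shifts, attained exactly at `0` and `π`
    P.Vminus 0 0 0 0 = P.Vnops ∧
    P.Vnops = 2 * ((P.c₁ + 2 * P.c₂ + P.c₃) / (P.c₄ - P.c₅)) ∧
    (∀ m ∈ Set.Ioc (-Real.pi) Real.pi,
      P.Vnops ≤ P.Vim m ∧ (P.Vim m = P.Vnops ↔ m = 0 ∨ m = Real.pi)) ∧
    -- the maximum, attained exactly at `±π/2`, exceeds `2`
    (∀ m ∈ Set.Ioc (-Real.pi) Real.pi,
      P.Vim m ≤ 2 * ((P.c₁ - P.c₃) / (P.c₄ + P.c₅)) ∧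
      (P.Vim m = 2 * ((P.c₁ - P.c₃) / (P.c₄ + P.c₅)) ↔
        m = Real.pi / 2 ∨ m = -(Real.pi / 2))) ∧
    2 < 2 * ((P.c₁ - P.c₃) / (P.c₄ + P.c₅)) ∧
    -- if the network without phase shifts is EPR entangled: the four roots and the exact range
    -- of `m` on which EPR entanglement exists
    (P.EPREntangled 0 0 0 0 →
      ∃ m₁ m₂ : ℝ, 0 < m₁ ∧ m₁ < Real.pi / 2 ∧ Real.pi / 2 < m₂ ∧ m₂ < Real.pi ∧
        {m ∈ Set.Ioc (-Real.pi) Real.pi | P.Vim m = 2} = {m₁, -m₁, m₂, -m₂} ∧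
        ∀ m ∈ Set.Ioc (-Real.pi) Real.pi, ∀ n φ₁ φ₂ : ℝ,
          NOPAParams.IsOptimalPhase m n (φ₁ + φ₂) →
          (P.EPREntangled (n + m) (n - m) φ₁ φ₂ ↔
            m ∈ Set.Ioo (-Real.pi) (-m₂) ∪ Set.Ioo (-m₁) m₁ ∪ Set.Ioc m₂ Real.pi) ∧
          (P.EPREntangledUpToRotation (n + m) (n - m) φ₁ φ₂ ↔
            m ∈ Set.Ioo (-Real.pi) (-m₂) ∪ Set.Ioo (-m₁) m₁ ∪ Set.Ioc m₂ Real.pi)) := by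

  have hγr := NOPAParams.γr_pos
  have hγr_le : NOPAParams.γr ≤ P.γ := by
    rw [hγ, le_div_iff₀ hy.1]
    exact mul_le_of_le_one_right hγr.le hy.2
  have hε0 : 0 < P.ε := hε ▸ mul_pos hx.1 hγr
  have hγ0 : 0 < P.γ := hγr.trans_le hγr_le
  have h : P.Stable := ⟨hε0, hγ0, hκ.1, hα.1, hα.2,
    P.gain_lt_of_isHurwitz hε0 hγ0 hα.1 hstab⟩
  have hεγ : P.ε ≤ P.γ := by
    rw [hε]
    exact (mul_le_of_le_one_left hγr.le hx.2).trans hγr_le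
  -- The bounds $\kappa\le\kappa_r x$ and $20\kappa_r\le\gamma_r$ even give $20\kappa\le\epsilon$; a
  -- factor $2$ suffices.
  have hκε : 2 * P.κ ≤ P.ε := by
    have h1 := mul_le_mul_of_nonneg_right NOPAParams.κr_le hx.1.le
    rw [hε]
    linarith [hκ.1, hκ.2]
  have hκε' : P.κ ≤ P.ε := by linarith [hκ.1]
  have hanti := h.strictAntiOn_profile hκε'
  have h0 : (0 : ℝ) ∈ Set.Icc (0 : ℝ) 1 := by simp
  have h1 : (1 : ℝ) ∈ Set.Icc (0 : ℝ) 1 := by simp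
  refine ⟨fun m hm n φ₁ φ₂ => ?_, h.strictMonoOn_Vim_left hκε', h.strictAntiOn_Vim_left hκε',
    h.strictMonoOn_Vim_right hκε', h.strictAntiOn_Vim_right hκε', h.Vminus_zero,
    h.Vnops_eq.trans P.profile_one, fun m hm => ?_, fun m hm => ?_, ?_, fun hE => ?_⟩
  · rw [h.Vminus_eq]
    exact ⟨fun hφ => ⟨h.Vplus_eq_Vim hm hφ, h.Vplus_eq_Vim hm hφ⟩,
      h.Vim_le_Vplus hκε' hεγ hm n φ₁ φ₂, h.Vim_le_Vplus hκε' hεγ hm n φ₁ φ₂⟩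
  · have hc := NOPAParams.abs_cos_mem_Icc m
    rw [h.Vnops_eq, P.Vim_eq_profile hm, ← NOPAParams.abs_cos_eq_one_iff hm,
      hanti.injOn.eq_iff hc h1]
    exact ⟨hanti.antitoneOn hc h1 hc.2, Iff.rfl⟩
  · have hc := NOPAParams.abs_cos_mem_Icc m
    rw [← P.profile_zero, P.Vim_eq_profile hm, ← NOPAParams.cos_eq_zero_iff_of_mem_Ioc hm,
      hanti.injOn.eq_iff hc h0, abs_eq_zero]
    exact ⟨hanti.antitoneOn h0 hc hc.1, Iff.rfl⟩
  · rw [← P.profile_zero]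
    exact h.two_lt_profile_zero hκε
  · have hV : P.Vnops < 2 := by
      rw [NOPAParams.EPREntangled, h.Vminus_zero, ← NOPAParams.Vnops] at hE
      linarith
    obtain ⟨m₁, m₂, h₁, h₂, h₃, h₄, hset, hlt⟩ := h.exists_threshold hκε hV
    refine ⟨m₁, m₂, h₁, h₂, h₃, h₄, hset, fun m hm n φ₁ φ₂ hφ => ?_⟩
    rw [h.EPREntangled_iff hm hφ, h.EPREntangledUpToRotation_iff hκε' hεγ hm hφ]
    exact ⟨hlt m hm, hlt m hm⟩
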